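/- Let $\mathcal{M}$ be a von Neumann algebra acting on a complex Hilbert space, let $\mathcal{M}_*$ be the space of normal (ultraweakly continuous linear) functionals on $\mathcal{M}$, and let $\mathcal{M}_*^h$ and $\mathcal{M}_*^+$ be the sets of Hermitian and of positive functionals in $\mathcal{M}_*$. For $x\in\mathcal{M}$ and $\varphi\in\mathcal{M}_*$, write $x\varphi$, $\varphi x$ and $x\varphi x$ for the functionals $y\mapsto\varphi(xy)$, $y\mapsto\varphi(yx)$ and $y\mapsto\varphi(xyx)$. For $\varphi\in\mathcal{M}_*$, let $|\varphi|\in\mathcal{M}_*^+$ be its absolute value, that is, $\varphi=u|\varphi|$ is the polar decomposition of $\varphi$, where $u\in\mathcal{M}$ is a partial isometry such that $uu^*$ is the support projection of $|\varphi|$ (so that $|\varphi|=u^*\varphi$). For $\varphi\in\mathcal{M}_*^h$, let $\varphi^+\in\mathcal{M}_*^+$ be the positive part in its Jordan decomposition $\varphi=\varphi^+-\varphi^-$, where $\varphi^{\pm}\in\mathcal{M}_*^+$ and $\|\varphi\|=\|\varphi^+\|+\|\varphi^-\|$. For functionals, $\varphi\le\psi$ means that $\psi-\varphi$ is positive. Then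 for every positive $a\in\mathcal{M}$ the following conditions are equivalent: (i) $a$ lies in the center of $\mathcal{M}$; (ii) $pap\le a$ for every projection $p\in\mathcal{M}$; (iii) $\varphi^+(a)\le\varphi_1(a)$ for every $\varphi\in\mathcal{M}_*^h$ and every decomposition $\varphi=\varphi_1-\varphi_2$ with $\varphi_1,\varphi_2\in\mathcal{M}_*^+$; (iv) the map $\varphi\mapsto\varphi^+(a)$ is monotone on $\mathcal{M}_*^h$, i.e. $\varphi\le\psi$ implies $\varphi^+(a)\le\psi^+(a)$ for all $\varphi,\psi\in\mathcal{M}_*^h$; (v) the map $\varphi\mapsto\varphi^+(a)$ is subadditive on $\mathcal{M}_*^h$, i.e. $(\varphi+\psi)^+(a)\le\varphi^+(a)+\psi^+(a)$ for all $\varphi,\psi\in\mathcal{M}_*^h$; (vi) the map $\varphi\mapsto|\varphi|(a)$ is subadditive on $\mathcal{M}_*^h$, i.e. $|\varphi+\psi|(a)\le|\varphi|(a)+|\psi|(a)$ for all $\varphi,\psi\in\mathcal{M}_*^h$; (vii) the map $\varphi\mapsto\varphi^+(a)$ is convex on $\mathcal{M}_*^h$; (viii) the map $\varphi\mapsto|\varphi|(a)$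 is convex on $\mathcal{M}_*^h$; (ix) $|\varphi|(a)=\|a^{1/2}\varphi a^{1/2}\|$ for all $\varphi\in\mathcal{M}_*$; (x) the map $\varphi\mapsto|\varphi|(a)$ is subadditive on $\mathcal{M}_*$, i.e. $|\varphi+\psi|(a)\le|\varphi|(a)+|\psi|(a)$ for all $\varphi,\psi\in\mathcal{M}_*$. -/

import Mathlib

open scoped ComplexOrder InnerProductSpace

namespace VonNeumannAlgebra

variable {H : Type*} [NormedAddCommGroup H] [InnerProductSpace ℂ H] [CompleteSpace H]

/-- Bounded linear functionals on a von Neumann algebra `M ⊆ B(H)`, with the operator norm.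
Elements of `M` carry the operator norm and the (Loewner) order of `B(H)`. -/
abbrev Functional (M : VonNeumannAlgebra H) : Type _ := StrongDual ℂ M.toStarSubalgebra

variable {M : VonNeumannAlgebra H}

/-- Normal functionals: the ultraweakly continuous ones, that is, those of the form
`x ↦ ∑ₙ ⟪ηₙ, x ξₙ⟫` with `∑ₙ ‖ξₙ‖² < ∞` and `∑ₙ ‖ηₙ‖² < ∞`.
The space of these functionals is the predual of `M`. -/
def IsNormal (φ : Functional M) : Prop :=
  ∃ ξ η : ℕ → H, Summable (fun n => ‖ξ n‖ ^ 2) ∧ Summable (fun n => ‖η n‖ ^ 2) ∧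
    ∀ x : M.toStarSubalgebra, HasSum (fun n => ⟪η n, (x : H →L[ℂ] H) (ξ n)⟫_ℂ) (φ x)

/-- Hermitian functionals. -/
def IsHermitian (φ : Functional M) : Prop :=
  ∀ x : M.toStarSubalgebra, φ (star x) = star (φ x)

/-- Positive functionals. -/
def IsPositive (φ : Functional M) : Prop :=
  ∀ x : M.toStarSubalgebra, 0 ≤ x → 0 ≤ φ x

/-- The Hermitian part of the predual. -/
def hermitianPredual (M : VonNeumannAlgebra H) : Set (Functional M) :=
  {φ | IsNormal φ ∧ IsHermitian φ}

/-- The positive part of the predual. -/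
def positivePredual (M : VonNeumannAlgebra H) : Set (Functional M) :=
  {φ | IsNormal φ ∧ IsPositive φ}

/-- The functional `x φ : y ↦ φ (x y)`. -/
noncomputable def lmul (x : M.toStarSubalgebra) (φ : Functional M) : Functional M :=
  φ ∘L ContinuousLinearMap.mul ℂ M.toStarSubalgebra x

/-- The functional `φ x : y ↦ φ (y x)`. -/
noncomputable def rmul (φ : Functional M) (x : M.toStarSubalgebra) : Functional M :=
  φ ∘L (ContinuousLinearMap.mul ℂ M.toStarSubalgebra).flip x

@[simp]
theorem lmul_apply (x : M.toStarSubalgebra) (φ : Functional M) (y : M.toStarSubalgebra) :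
    lmul x φ y = φ (x * y) := rfl

@[simp]
theorem rmul_apply (φ : Functional M) (x : M.toStarSubalgebra) (y : M.toStarSubalgebra) :
    rmul φ x y = φ (y * x) := rfl

/-- `p` is the support projection of the positive functional `ω`: the smallest projection `p`
of `M` with `ω (1 - p) = 0`. -/
def IsSupport (ω : Functional M) (p : M.toStarSubalgebra) : Prop :=
  IsStarProjection p ∧ ω (1 - p) = 0 ∧
    ∀ q : M.toStarSubalgebra, IsStarProjection q → ω (1 - q) = 0 → p ≤ q

/-- `ω` is the absolute value of `φ`, i.e. `φ = u ω` is the polar decomposition of `φ`: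
`ω` is a positive normal functional and `u ∈ M` is a partial isometry such that `u u*` is the
support projection of `ω` (with `u ω : y ↦ ω (u y)` one then has `ω = u* φ`). -/
def IsAbsoluteValue (φ ω : Functional M) : Prop :=
  ω ∈ positivePredual M ∧ ∃ u : M.toStarSubalgebra, IsSupport ω (u * star u) ∧ φ = lmul u ω

/-- The absolute value `|φ|` of a normal functional `φ`. -/
noncomputable def absoluteValue (φ : Functional M) : Functional M :=
  Classical.epsilon (fun ω => IsAbsoluteValue φ ω)

/-- `ψ` is the positive part of the Jordan decomposition of `φ`: for some `χ` one has
`φ = ψ - χ` with `ψ`, `χ` positive normal and `‖φ‖ = ‖ψ‖ + ‖χ‖`. -/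
def IsPositivePart (φ ψ : Functional M) : Prop :=
  ψ ∈ positivePredual M ∧ ∃ χ ∈ positivePredual M, φ = ψ - χ ∧ ‖φ‖ = ‖ψ‖ + ‖χ‖

/-- The positive part `φ⁺` of a Hermitian normal functional `φ`. -/
noncomputable def positivePart (φ : Functional M) : Functional M :=
  Classical.epsilon (fun ψ => IsPositivePart φ ψ)

/-- A von Neumann algebra contains the square roots of its elements. -/
theorem sqrt_mem (a : M.toStarSubalgebra) :
    CFC.sqrt (a : H →L[ℂ] H) ∈ M.toStarSubalgebra := by
  have key : CFC.sqrt (a : H →L[ℂ] H) ∈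
      Set.centralizer (Set.centralizer (M : Set (H →L[ℂ] H))) := by
    intro y hy
    have hc : Commute (a : H →L[ℂ] H) y := hy _ a.2
    exact (Commute.cfcₙ_nnreal hc NNReal.sqrt).symm
  rw [centralizer_centralizer] at key
  exact key

/-- The positive square root of a positive element of `M`, as an element of `M`. -/
noncomputable def sqrt (a : M.toStarSubalgebra) : M.toStarSubalgebra :=
  ⟨CFC.sqrt (a : H →L[ℂ] H), sqrt_mem a⟩

end VonNeumannAlgebra

/-! ### Order, norm and square roots inside `M`. -/

namespace VonNeumannAlgebra

variable {H : Type*} [NormedAddCommGroup H] [InnerProductSpace ℂ H] [CompleteSpace H]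
variable {M : VonNeumannAlgebra H}

/-! Centrality gives (iii) because a Hermitian normal `φ` attains its norm at a self-adjoint
contraction `v`, and then `φ⁺ = (vφ + φ)/2`. For `φ = φ₁ - φ₂` this makes `2(φ₁(a) - φ⁺(a)) =
φ₁((1-v)a) + φ₂((1+v)a)`, and for central `a` both arguments are positive, being `√a (1 ∓ v) √a`.

(iii) gives (ii) by testing on `φ = pωp - (t⁻² - 1) qωq`, where `q = 1 - p` and `ω` is a vector
functional. Its positive part is `pωp`, but also `φ = (ω + t² pωp) - cωc` with `c = tp + t⁻¹q`.
Hence `ω(pap) ≤ ω(a) + t² ω(pap)`; let `t → 0`.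

(ii) gives (i): `b = a - pap ≥ 0` satisfies `pbp = 0`, so `bp = 0` and `a` commutes with `p`.
Commuting with projections suffices by repeated approximation (`exists_projection_double_sub`).

Conditions (iv)-(viii) are linked to (iii) by elementary decompositions, by `|φ| = 2φ⁺ - φ`, and by
positive homogeneity. For (ix), a central `√a` passes through the polar decomposition; (x) is then
the triangle inequality for the norm.

Since `|φ|` and `φ⁺` are chosen by `epsilon`, existence and uniqueness must be proved. Weak
compactness of the unit ball provides a norming `v`, with `vφ` positive
(`isPositive_lmul_of_apply_eq_norm`) and `v*vφ = φ` (`apply_mul_star_mul`). The support projection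
comes from writing a positive normal functional as `∑ ⟪ζₙ, · ζₙ⟫`. -/

theorem nonneg_coe_iff {x : M.toStarSubalgebra} : 0 ≤ x ↔ 0 ≤ (x : H →L[ℂ] H) := Iff.rfl

theorem sqrt_mul_sqrt {a : M.toStarSubalgebra} (ha : 0 ≤ a) : sqrt a * sqrt a = a :=
  Subtype.ext (CFC.sqrt_mul_sqrt_self (a : H →L[ℂ] H) ha)

theorem sqrt_nonneg (a : M.toStarSubalgebra) : 0 ≤ sqrt a :=
  CFC.sqrt_nonneg (a : H →L[ℂ] H)

theorem star_sqrt (a : M.toStarSubalgebra) : star (sqrt a) = sqrt a :=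
  Subtype.ext (CFC.sqrt_nonneg (a : H →L[ℂ] H)).isSelfAdjoint.star_eq

/-- Positivity is inherited from `B(H)`; it is intrinsic to `M` because square roots of positive
elements stay in `M`. -/
instance instStarOrderedRing : StarOrderedRing M.toStarSubalgebra :=
  StarOrderedRing.of_nonneg_iff' (fun h z => by
      have : (_ : H →L[ℂ] H) ≤ _ := h
      exact add_le_add_right this (z : H →L[ℂ] H))
    (fun x => by
      constructor
      · intro hx
        exact ⟨sqrt x, by rw [star_sqrt, sqrt_mul_sqrt hx]⟩
      · rintro ⟨s, rfl⟩
        exact star_mul_self_nonneg (s : H →L[ℂ] H))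

theorem one_sub_nonneg_of_norm_le_one {x : M.toStarSubalgebra} (hx : IsSelfAdjoint x)
    (h : ‖x‖ ≤ 1) : 0 ≤ 1 - x := by
  have hx' : IsSelfAdjoint (x : H →L[ℂ] H) := congrArg Subtype.val hx
  have h1 := hx'.le_algebraMap_norm_self
  have h2 : algebraMap ℝ (H →L[ℂ] H) ‖(x : H →L[ℂ] H)‖ ≤ algebraMap ℝ (H →L[ℂ] H) 1 :=
    algebraMap_mono _ h
  rw [nonneg_coe_iff]
  have := h1.trans h2
  rw [map_one] at this
  exact sub_nonneg.2 this

theorem norm_le_one_of_nonneg {x : M.toStarSubalgebra} (h0 : 0 ≤ x) (h1 : x ≤ 1) : ‖x‖ ≤ 1 := by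
  have := (CStarAlgebra.norm_le_one_iff_of_nonneg (x : H →L[ℂ] H) h0).2 h1
  exact this

theorem norm_le_one_of_star_mul_self {x : M.toStarSubalgebra} (h1 : star x * x ≤ 1) : ‖x‖ ≤ 1 := by
  have h := norm_le_one_of_nonneg (star_mul_self_nonneg x) h1
  rw [CStarRing.norm_star_mul_self] at h
  nlinarith [norm_nonneg x]

theorem norm_one_le : ‖(1 : M.toStarSubalgebra)‖ ≤ 1 :=
  norm_le_one_of_nonneg zero_le_one le_rfl

theorem star_mul_self_le_one {x : M.toStarSubalgebra} (hx : ‖x‖ ≤ 1) : star x * x ≤ 1 := by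
  refine sub_nonneg.1 (one_sub_nonneg_of_norm_le_one (IsSelfAdjoint.star_mul_self x) ?_)
  rw [CStarRing.norm_star_mul_self]
  nlinarith [norm_nonneg x]

/-! ### Positive functionals: Cauchy-Schwarz and the criterion `ω(1) = ‖ω‖`. -/

section Positive

variable {ω : Functional M}

theorem IsPositive.star_mul_self_nonneg (hω : IsPositive ω) (x : M.toStarSubalgebra) :
    0 ≤ ω (star x * x) :=
  hω _ (_root_.star_mul_self_nonneg x)

/-- Polarization: `ω` is real on `y*y` for `y = 1, x, 1 + x, 1 + ix`, which determines `ω(x*)` from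
`ω(x)`. -/
theorem IsPositive.isHermitian (hω : IsPositive ω) : IsHermitian ω := by
  intro x
  have h0 := (Complex.nonneg_iff.1 (hω.star_mul_self_nonneg 1)).2
  have h1 := (Complex.nonneg_iff.1 (hω.star_mul_self_nonneg x)).2
  have h2 := (Complex.nonneg_iff.1 (hω.star_mul_self_nonneg (1 + x))).2
  have h3 := (Complex.nonneg_iff.1 (hω.star_mul_self_nonneg (1 + Complex.I • x))).2
  simp only [star_add, star_smul, star_one, add_mul, mul_add, one_mul, mul_one, map_add,
    map_smul, smul_mul_assoc, mul_smul_comm, smul_eq_mul, Complex.add_im, Complex.star_def,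
    Complex.conj_I, Complex.mul_im, Complex.mul_re, Complex.I_re, Complex.I_im, Complex.neg_re,
    Complex.neg_im] at h0 h1 h2 h3
  apply Complex.ext <;> simp <;> linarith

theorem IsPositive.norm_sq_le (hω : IsPositive ω) (x y : M.toStarSubalgebra) :
    ‖ω (star x * y)‖ ^ 2 ≤ (ω (star x * x)).re * (ω (star y * y)).re := by
  let c : PreInnerProductSpace.Core ℂ M.toStarSubalgebra :=
    { inner := fun x y => ω (star x * y)
      conj_inner_symm := fun x y => by
        rw [← Complex.star_def, ← hω.isHermitian]; simp
      re_inner_nonneg := fun x => (Complex.nonneg_iff.1 (hω.star_mul_self_nonneg x)).1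
      add_left := fun x y z => by simp [add_mul]
      smul_left := fun x y r => by simp }
  have h := @InnerProductSpace.Core.inner_mul_inner_self_le ℂ M.toStarSubalgebra _ _ _ c x y
  have h' : ‖ω (star y * x)‖ = ‖ω (star x * y)‖ := by
    have : star y * x = star (star x * y) := by simp
    rw [this, hω.isHermitian, norm_star]
  change ‖ω (star x * y)‖ * ‖ω (star y * x)‖ ≤ _ at h
  rw [h', ← sq] at h
  exact h

theorem IsPositive.apply_star_mul_eq_zero (hω : IsPositive ω) {x : M.toStarSubalgebra}
    (hx : ω (star x * x) = 0) (y : M.toStarSubalgebra) : ω (star x * y) = 0 := by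
  have h := hω.norm_sq_le x y
  rw [hx] at h
  simpa using (sq_nonneg _).antisymm (h.trans_eq (by simp)) |>.symm

theorem IsPositive.mono (hω : IsPositive ω) {x y : M.toStarSubalgebra} (h : x ≤ y) :
    ω x ≤ ω y := by
  have := hω _ (sub_nonneg.2 h)
  rwa [map_sub, sub_nonneg] at this

theorem IsPositive.norm_apply_le (hω : IsPositive ω) (y : M.toStarSubalgebra) :
    ‖ω y‖ ≤ (ω 1).re * ‖y‖ := by
  have h1 : 0 ≤ (ω 1).re := (Complex.nonneg_iff.1 (hω 1 zero_le_one)).1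
  refine (LinearMap.bound_of_ball_bound' one_pos (ω 1).re (ω : M.toStarSubalgebra →ₗ[ℂ] ℂ)
    ?_ y).trans ?_
  · intro z hz
    have hz' : ‖z‖ ≤ 1 := by simpa using hz
    have h := hω.norm_sq_le 1 z
    have h2 := (Complex.le_def.1 (hω.mono (star_mul_self_le_one hz'))).1
    simp only [star_one, one_mul] at h
    have h3 := h.trans (mul_le_mul_of_nonneg_left h2 h1)
    rw [← sq] at h3
    exact (sq_le_sq₀ (norm_nonneg _) h1).1 h3
  · simp

theorem IsPositive.norm_eq (hω : IsPositive ω) : ‖ω‖ = (ω 1).re := by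
  have h1 : 0 ≤ (ω 1).re := (Complex.nonneg_iff.1 (hω 1 zero_le_one)).1
  refine le_antisymm (ω.opNorm_le_bound h1 hω.norm_apply_le) ?_
  refine (Complex.re_le_norm _).trans ((ω.le_opNorm 1).trans ?_)
  exact mul_le_of_le_one_right (norm_nonneg _) norm_one_le

theorem IsPositive.apply_one (hω : IsPositive ω) : ω 1 = (‖ω‖ : ℂ) := by
  rw [hω.norm_eq]
  exact (Complex.nonneg_iff.1 (hω 1 zero_le_one)) |>.2 |> fun h => by
    apply Complex.ext <;> simp [← h]

/-- On `x + it` the imaginary part of the value grows linearly with slope `‖ω‖`, while the squared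
norm is at most `‖x‖² + t²`; a nonzero `Im ω(x)` would violate the norm bound for a suitable `t`. -/
theorem im_eq_zero_of_norm_le_apply_one (h : ω 1 = (‖ω‖ : ℂ)) {x : M.toStarSubalgebra}
    (hx : IsSelfAdjoint x) : (ω x).im = 0 := by
  have key : ∀ t : ℝ, ((ω x).im + t * ‖ω‖) ^ 2 ≤ ‖ω‖ ^ 2 * (‖x‖ ^ 2 + t ^ 2) := by
    intro t
    set z : M.toStarSubalgebra := x + (t * Complex.I : ℂ) • 1 with hz
    have h1 : ‖z‖ ^ 2 ≤ ‖x‖ ^ 2 + t ^ 2 := by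
      have : star z * z = x * x + ((t ^ 2 : ℝ) : ℂ) • 1 := by
        simp only [hz, star_add, star_smul, hx.star_eq, star_one, add_mul, mul_add, smul_mul_assoc,
          mul_smul_comm, one_mul, mul_one, star_mul', Complex.star_def, Complex.conj_I,
          Complex.conj_ofReal, smul_add, smul_smul]
        have e : (t : ℂ) * Complex.I * (t * -Complex.I) = ((t ^ 2 : ℝ) : ℂ) := by
          push_cast; linear_combination (-(t : ℂ) ^ 2) * Complex.I_sq
        rw [e]
        simp only [mul_neg, neg_smul]
        abel
      rw [sq, ← CStarRing.norm_star_mul_self, this]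
      refine (norm_add_le _ _).trans (add_le_add ((norm_mul_le _ _).trans_eq (sq _).symm) ?_)
      rw [norm_smul, Complex.norm_real, Real.norm_of_nonneg (sq_nonneg t)]
      exact mul_le_of_le_one_right (sq_nonneg t) norm_one_le
    have h2 : (ω z).im = (ω x).im + t * ‖ω‖ := by
      simp [hz, h]
    rw [← h2]
    calc (ω z).im ^ 2 ≤ ‖ω z‖ ^ 2 := by
          rw [← sq_abs]; gcongr; exact Complex.abs_im_le_norm _
      _ ≤ (‖ω‖ * ‖z‖) ^ 2 := by gcongr; exact ω.le_opNorm z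
      _ = ‖ω‖ ^ 2 * ‖z‖ ^ 2 := by ring
      _ ≤ _ := by gcongr
  have h0 : ‖(ω x).im‖ ≤ ‖ω‖ * ‖x‖ := (Complex.abs_im_le_norm _).trans (ω.le_opNorm x)
  by_contra hne
  rcases eq_or_ne ‖ω‖ 0 with h3 | h3
  · rw [h3] at h0; simp at h0; exact hne h0
  -- This `t` makes the cross term exceed `‖ω‖²‖x‖²` by one.
  · have := key (((‖ω‖ ^ 2 * ‖x‖ ^ 2 + 1) / (2 * (ω x).im * ‖ω‖)))
    have h4 : 2 * (ω x).im * ‖ω‖ * ((‖ω‖ ^ 2 * ‖x‖ ^ 2 + 1) / (2 * (ω x).im * ‖ω‖)) =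
      ‖ω‖ ^ 2 * ‖x‖ ^ 2 + 1 := by field_simp
    nlinarith [sq_nonneg (ω x).im]

theorem isPositive_of_apply_one (h : ω 1 = (‖ω‖ : ℂ)) : IsPositive ω := by
  have key : ∀ x : M.toStarSubalgebra, 0 ≤ x → x ≤ 1 → 0 ≤ ω x := by
    intro x hx hx1
    have h1 : ‖1 - x‖ ≤ 1 := norm_le_one_of_nonneg (sub_nonneg.2 hx1) (sub_le_self _ hx)
    have h2 := im_eq_zero_of_norm_le_apply_one h (IsSelfAdjoint.of_nonneg hx)
    have h3 := (Complex.re_le_norm (ω (1 - x))).trans (ω.le_opNorm _)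
    rw [map_sub, h] at h3
    have h4 := mul_le_of_le_one_right (norm_nonneg ω) h1
    rw [Complex.nonneg_iff]
    simp only [Complex.sub_re, Complex.ofReal_re] at h3
    exact ⟨by linarith, h2.symm⟩
  intro x hx
  have hs : (0 : ℝ) < (‖x‖ + 1)⁻¹ := by positivity
  have hx' : 0 ≤ (x : H →L[ℂ] H) := hx
  have h1 : 0 ≤ (((‖x‖ + 1)⁻¹ : ℝ) : ℂ) • x := by
    rw [nonneg_coe_iff]
    exact smul_nonneg (by exact_mod_cast hs.le) hx'
  have h2 := key _ h1 (by
    refine sub_nonneg.1 (one_sub_nonneg_of_norm_le_one (IsSelfAdjoint.of_nonneg h1) ?_)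
    rw [norm_smul, Complex.norm_real, Real.norm_of_nonneg hs.le, inv_mul_le_iff₀ (by positivity)]
    linarith)
  rw [map_smul, smul_eq_mul] at h2
  have h5 : (0 : ℂ) ≤ ((‖x‖ + 1 : ℝ) : ℂ) := by exact_mod_cast (by positivity : 0 ≤ ‖x‖ + 1)
  have h6 := mul_nonneg h5 h2
  rw [← mul_assoc, ← Complex.ofReal_mul, mul_inv_cancel₀ (by positivity)] at h6
  simpa using h6

end Positive

end VonNeumannAlgebra

/-! ### Normal functionals and weak compactness of the unit ball. -/

namespace VonNeumannAlgebra

open Filter Topology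

variable {H : Type*} [NormedAddCommGroup H] [InnerProductSpace ℂ H] [CompleteSpace H]
variable {M : VonNeumannAlgebra H}

section Normal

variable {φ ψ : Functional M}

theorem summable_norm_mul_norm {E F : Type*} [SeminormedAddCommGroup E] [SeminormedAddCommGroup F]
    {ξ : ℕ → E} {η : ℕ → F} (hξ : Summable fun n => ‖ξ n‖ ^ 2)
    (hη : Summable fun n => ‖η n‖ ^ 2) : Summable fun n => ‖ξ n‖ * ‖η n‖ :=
  Summable.of_nonneg_of_le (fun _ => by positivity)
    (fun n => by nlinarith [sq_nonneg (‖ξ n‖ - ‖η n‖), norm_nonneg (ξ n), norm_nonneg (η n)])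
    (hξ.add hη)

theorem summable_norm_sq_apply {E : Type*} [NormedAddCommGroup E] [NormedSpace ℂ E] {ξ : ℕ → E}
    (hξ : Summable fun n => ‖ξ n‖ ^ 2) (x : E →L[ℂ] E) :
    Summable fun n => ‖x (ξ n)‖ ^ 2 :=
  Summable.of_nonneg_of_le (fun _ => by positivity)
    (fun n => by rw [← mul_pow]; gcongr; exact x.le_opNorm _) (hξ.mul_left (‖x‖ ^ 2))

theorem inner_star_apply {E : Type*} [NormedAddCommGroup E] [InnerProductSpace ℂ E]
    [CompleteSpace E] (x : E →L[ℂ] E) (ξ η : E) : ⟪(star x) η, ξ⟫_ℂ = ⟪η, x ξ⟫_ℂ := by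
  rw [ContinuousLinearMap.star_eq_adjoint, ContinuousLinearMap.adjoint_inner_left]

theorem IsNormal.left_mul (hφ : IsNormal φ) (x : M.toStarSubalgebra) : IsNormal (lmul x φ) := by
  obtain ⟨ξ, η, hξ, hη, h⟩ := hφ
  refine ⟨ξ, fun n => (star (x : H →L[ℂ] H)) (η n), hξ,
    summable_norm_sq_apply hη _, fun y => ?_⟩
  simpa [inner_star_apply] using h (x * y)

theorem IsNormal.right_mul (hφ : IsNormal φ) (x : M.toStarSubalgebra) : IsNormal (rmul φ x) := by
  obtain ⟨ξ, η, hξ, hη, h⟩ := hφ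
  refine ⟨fun n => (x : H →L[ℂ] H) (ξ n), η, summable_norm_sq_apply hξ _, hη, fun y => ?_⟩
  simpa using h (y * x)

theorem IsNormal.smul (hφ : IsNormal φ) (c : ℂ) : IsNormal (c • φ) := by
  obtain ⟨ξ, η, hξ, hη, h⟩ := hφ
  refine ⟨fun n => c • ξ n, η, by simpa [norm_smul, mul_pow] using hξ.mul_left _, hη,
    fun y => ?_⟩
  simpa [inner_smul_right] using (h y).mul_left c

theorem IsNormal.add (hφ : IsNormal φ) (hψ : IsNormal ψ) : IsNormal (φ + ψ) := by
  obtain ⟨ξ, η, hξ, hη, h⟩ := hφ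
  obtain ⟨ξ', η', hξ', hη', h'⟩ := hψ
  -- The two representing sequences are interleaved into one.
  let e := Equiv.natSumNatEquivNat.symm
  refine ⟨Sum.elim ξ ξ' ∘ e, Sum.elim η η' ∘ e, ?_, ?_, fun x => ?_⟩
  · exact (e.summable_iff (f := fun s => ‖Sum.elim ξ ξ' s‖ ^ 2)).2 (Summable.sum _ hξ hξ')
  · exact (e.summable_iff (f := fun s => ‖Sum.elim η η' s‖ ^ 2)).2 (Summable.sum _ hη hη')
  · exact (e.hasSum_iff (f := fun s => ⟪Sum.elim η η' s, (x : H →L[ℂ] H) (Sum.elim ξ ξ' s)⟫_ℂ)).2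
      (HasSum.sum (h x) (h' x))

theorem IsNormal.neg (hφ : IsNormal φ) : IsNormal (-φ) := by
  have h : (-1 : ℂ) • φ = -φ := by ext; simp
  exact h ▸ hφ.smul (-1)

theorem IsNormal.sub (hφ : IsNormal φ) (hψ : IsNormal ψ) : IsNormal (φ - ψ) := by
  rw [sub_eq_add_neg]
  exact hφ.add hψ.neg

end Normal

/-- Matrix coefficients are bounded, so they converge along the ultrafilter; the limit is a bounded
sesquilinear form, hence an operator. -/
theorem exists_weak_limit (U : Ultrafilter ℕ) {x : ℕ → M.toStarSubalgebra}
    (hx : ∀ n, ‖x n‖ ≤ 1) :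
    ∃ y : M.toStarSubalgebra, ‖y‖ ≤ 1 ∧ ∀ ξ η : H,
      Tendsto (fun n => ⟪η, (x n : H →L[ℂ] H) ξ⟫_ℂ) U (𝓝 ⟪η, (y : H →L[ℂ] H) ξ⟫_ℂ) := by
  have hb : ∀ n (ξ η : H), ‖⟪(x n : H →L[ℂ] H) ξ, η⟫_ℂ‖ ≤ ‖ξ‖ * ‖η‖ := fun n ξ η =>
    (norm_inner_le_norm _ _).trans (by
      gcongr
      exact (x n : H →L[ℂ] H).le_of_opNorm_le (hx n) ξ |>.trans_eq (one_mul _))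
  have hlim : ∀ ξ η : H, ∃ c : ℂ, ‖c‖ ≤ ‖ξ‖ * ‖η‖ ∧
      Tendsto (fun n => ⟪(x n : H →L[ℂ] H) ξ, η⟫_ℂ) U (𝓝 c) := by
    intro ξ η
    obtain ⟨c, hc, hc'⟩ := (isCompact_closedBall (0 : ℂ) (‖ξ‖ * ‖η‖)).ultrafilter_le_nhds
      (U.map fun n => ⟪(x n : H →L[ℂ] H) ξ, η⟫_ℂ)
      (by
        rw [le_principal_iff, Ultrafilter.coe_map, mem_map]
        exact univ_mem' fun n => by simpa using hb n ξ η)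
    exact ⟨c, by simpa using hc, hc'⟩
  choose b hbn hbt using hlim
  let B : H →L⋆[ℂ] H →L[ℂ] ℂ := LinearMap.mkContinuous₂ (LinearMap.mk₂'ₛₗ (starRingEnd ℂ)
      (RingHom.id ℂ) b
      (fun ξ ξ' η => tendsto_nhds_unique (hbt _ _) (by
        simpa [inner_add_left] using (hbt ξ η).add (hbt ξ' η)))
      (fun c ξ η => tendsto_nhds_unique (hbt _ _) (by
        simpa [inner_smul_left, mul_comm] using (hbt ξ η).const_mul (starRingEnd ℂ c)))
      (fun ξ η η' => tendsto_nhds_unique (hbt _ _) (by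
        simpa [inner_add_right] using (hbt ξ η).add (hbt ξ η')))
      (fun c ξ η => tendsto_nhds_unique (hbt _ _) (by
        simpa [inner_smul_right] using (hbt ξ η).const_mul c))) 1
      (fun ξ η => by simpa using hbn ξ η)
  let y := InnerProductSpace.continuousLinearMapOfBilin B
  have hy : ∀ ξ η, ⟪y ξ, η⟫_ℂ = b ξ η := fun ξ η =>
    InnerProductSpace.continuousLinearMapOfBilin_apply B ξ η
  -- Commuting with a fixed `z` in the commutant survives weak limits, so the limit lies in the
  -- bicommutant.
  have hmem : y ∈ M.toStarSubalgebra := by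
    have : y ∈ Set.centralizer (Set.centralizer (M : Set (H →L[ℂ] H))) := by
      intro z hz
      ext ξ
      refine ext_inner_right ℂ fun η => ?_
      have h1 : ⟪y (z ξ), η⟫_ℂ = ⟪z (y ξ), η⟫_ℂ := by
        rw [hy, ← ContinuousLinearMap.adjoint_inner_right, hy]
        refine tendsto_nhds_unique (hbt _ _) ((hbt _ _).congr fun n => ?_)
        rw [ContinuousLinearMap.adjoint_inner_right]
        have h2 : (x n : H →L[ℂ] H) * z = z * (x n : H →L[ℂ] H) := hz _ (x n).2
        exact congrArg (fun f : H →L[ℂ] H => ⟪f ξ, η⟫_ℂ) h2.symm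
      exact h1.symm
    rw [centralizer_centralizer] at this
    exact this
  refine ⟨⟨y, hmem⟩, ?_, fun ξ η => ?_⟩
  · refine y.opNorm_le_bound zero_le_one fun ξ => ?_
    have h1 := hbn ξ (y ξ)
    rw [← hy, inner_self_eq_norm_sq_to_K, norm_pow] at h1
    simp only [Complex.coe_algebraMap, Complex.norm_real, norm_norm] at h1
    rcases eq_or_ne ‖y ξ‖ 0 with h0 | h0
    · rw [h0]; positivity
    · rw [one_mul]
      exact le_of_mul_le_mul_right (by rwa [← sq]) (lt_of_le_of_ne (norm_nonneg _) h0.symm)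
  · have h1 := (Complex.continuous_conj.tendsto _).comp (hbt ξ η)
    rw [← hy] at h1
    simpa [Function.comp_def] using h1

/-- On the unit ball the defining series is dominated by `∑ ‖ηₙ‖‖ξₙ‖`, so termwise convergence
suffices. -/
theorem IsNormal.tendsto {φ : Functional M} (hφ : IsNormal φ) {U : Filter ℕ}
    {x : ℕ → M.toStarSubalgebra} (hx : ∀ n, ‖x n‖ ≤ 1) {y : M.toStarSubalgebra}
    (h : ∀ ξ η : H, Tendsto (fun n => ⟪η, (x n : H →L[ℂ] H) ξ⟫_ℂ) U
      (𝓝 ⟪η, (y : H →L[ℂ] H) ξ⟫_ℂ)) :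
    Tendsto (fun n => φ (x n)) U (𝓝 (φ y)) := by
  obtain ⟨ξ, η, hξ, hη, hs⟩ := hφ
  simp_rw [← (hs _).tsum_eq]
  refine tendsto_tsum_of_dominated_convergence (summable_norm_mul_norm hη hξ)
    (fun k => h _ _) (.of_forall fun n k => (norm_inner_le_norm _ _).trans ?_)
  gcongr
  exact (x n : H →L[ℂ] H).le_of_opNorm_le (hx n) _ |>.trans_eq (one_mul _)

theorem IsNormal.exists_apply_eq_norm {φ : Functional M} (hφ : IsNormal φ) :
    ∃ v : M.toStarSubalgebra, ‖v‖ ≤ 1 ∧ φ v = (‖φ‖ : ℂ) := by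
  have h1 : ∀ n : ℕ, ∃ x : M.toStarSubalgebra, ‖x‖ ≤ 1 ∧ ‖φ‖ - 1 / ((n : ℝ) + 1) ≤ ‖φ x‖ := by
    intro n
    rcases (norm_nonneg φ).eq_or_lt with h | h
    · exact ⟨0, by simp, by rw [← h]; simp; positivity⟩
    · obtain ⟨x, hx, hx'⟩ := φ.exists_lt_apply_of_lt_opNorm
        (sub_lt_self ‖φ‖ (Nat.one_div_pos_of_nat (n := n)))
      exact ⟨x, hx.le, hx'.le⟩
  choose x hx hx' using h1
  obtain ⟨y, hy, hy'⟩ := exists_weak_limit (hyperfilter ℕ) hx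
  have h2 := (hφ.tendsto hx hy').norm
  have h3 : ‖φ‖ ≤ ‖φ y‖ := by
    have h4 : Tendsto (fun n : ℕ => ‖φ‖ - 1 / ((n : ℝ) + 1)) (hyperfilter ℕ) (𝓝 (‖φ‖ - 0)) :=
      (tendsto_const_nhds.sub tendsto_one_div_add_atTop_nhds_zero_nat).mono_left
        (Nat.hyperfilter_le_atTop)
    rw [sub_zero] at h4
    exact le_of_tendsto_of_tendsto' h4 h2 hx'
  have h5 : ‖φ y‖ = ‖φ‖ := le_antisymm ((φ.le_opNorm y).trans
    (mul_le_of_le_one_right (norm_nonneg _) hy)) h3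
  -- A rotation by the conjugate phase makes the value equal to the norm.
  obtain ⟨c, hc, hc'⟩ := Complex.exists_norm_mul_eq_self (φ y)
  have hc0 : starRingEnd ℂ c * c = 1 := by rw [Complex.conj_mul', hc]; simp
  refine ⟨starRingEnd ℂ c • y, ?_, ?_⟩
  · rw [norm_smul]; simpa [hc] using hy
  · rw [map_smul, ← hc', h5, smul_eq_mul]
    linear_combination (‖φ‖ : ℂ) * hc0

end VonNeumannAlgebra

/-! ### Polar decomposition from a norming element. -/

namespace VonNeumannAlgebra

variable {H : Type*} [NormedAddCommGroup H] [InnerProductSpace ℂ H] [CompleteSpace H]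
variable {M : VonNeumannAlgebra H} {φ ω ω' : Functional M}

/-- With `d = √(1 - vv*)` one has `vv* + dd* = 1`, so the row `(v, d)` is a contraction; it is
applied to the column `(1, z)`. -/
theorem norm_add_sqrt_mul_sq_le {v : M.toStarSubalgebra} (hv : ‖v‖ ≤ 1)
    (z : M.toStarSubalgebra) : ‖v + sqrt (1 - v * star v) * z‖ ^ 2 ≤ 1 + ‖z‖ ^ 2 := by
  have hd : 0 ≤ 1 - v * star v := by
    have := star_mul_self_le_one (x := star v) (by rwa [norm_star])
    rw [star_star] at this
    exact sub_nonneg.2 this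
  set d := sqrt (1 - v * star v) with hd_def
  have hdd : d * d = 1 - v * star v := sqrt_mul_sqrt hd
  have hds : star d = d := star_sqrt _
  have key : ∀ ξ : H, ‖(star (v : H →L[ℂ] H)) ξ‖ ^ 2 + ‖(d : H →L[ℂ] H) ξ‖ ^ 2 = ‖ξ‖ ^ 2 := by
    intro ξ
    have h0 : (d : H →L[ℂ] H) * d = (1 : H →L[ℂ] H) - v * star (v : H →L[ℂ] H) :=
      congrArg Subtype.val hdd
    have h1 := congrArg (fun x : H →L[ℂ] H => x ξ) h0
    have h2 : star (d : H →L[ℂ] H) = d := congrArg Subtype.val hds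
    have h3 : ⟪(d : H →L[ℂ] H) ξ, (d : H →L[ℂ] H) ξ⟫_ℂ =
        ⟪ξ, ((d : H →L[ℂ] H) * d) ξ⟫_ℂ := by
      nth_rw 1 [← h2]
      exact inner_star_apply (d : H →L[ℂ] H) _ _
    have h4 : ⟪ξ, ((v : H →L[ℂ] H) * star (v : H →L[ℂ] H)) ξ⟫_ℂ =
        ⟪(star (v : H →L[ℂ] H)) ξ, (star (v : H →L[ℂ] H)) ξ⟫_ℂ :=
      (inner_star_apply (v : H →L[ℂ] H) _ _).symm
    rw [h1, sub_apply, inner_sub_right, h4] at h3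
    simp only [inner_self_eq_norm_sq_to_K, one_apply_eq_self] at h3
    have h5 : ((‖(d : H →L[ℂ] H) ξ‖ ^ 2 : ℝ) : ℂ) =
      ((‖ξ‖ ^ 2 - ‖(star (v : H →L[ℂ] H)) ξ‖ ^ 2 : ℝ) : ℂ) := by
        push_cast; exact h3
    have h6 := Complex.ofReal_injective h5
    linarith
  have hbound : ‖((star (v + d * z) : M.toStarSubalgebra) : H →L[ℂ] H)‖ ≤ √(1 + ‖z‖ ^ 2) := by
    refine ContinuousLinearMap.opNorm_le_bound _ (Real.sqrt_nonneg _) fun ξ => ?_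
    have h1 : ((star (v + d * z) : M.toStarSubalgebra) : H →L[ℂ] H) ξ =
        (star (v : H →L[ℂ] H)) ξ + (star (z : H →L[ℂ] H)) ((d : H →L[ℂ] H) ξ) := by
      rw [star_add, star_mul, hds]
      rfl
    rw [h1, ← Real.sqrt_sq (norm_nonneg ξ), ← Real.sqrt_mul (by positivity)]
    refine Real.le_sqrt_of_sq_le ?_
    have h2 : ‖(star (z : H →L[ℂ] H)) ((d : H →L[ℂ] H) ξ)‖ ≤ ‖z‖ * ‖(d : H →L[ℂ] H) ξ‖ := by
      refine (ContinuousLinearMap.le_opNorm _ _).trans_eq ?_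
      rw [norm_star]; rfl
    have h3 := norm_add_le ((star (v : H →L[ℂ] H)) ξ)
      ((star (z : H →L[ℂ] H)) ((d : H →L[ℂ] H) ξ))
    rw [← key ξ]
    set p := ‖(star (v : H →L[ℂ] H)) ξ‖
    set q := ‖(d : H →L[ℂ] H) ξ‖
    calc _ ≤ (p + ‖z‖ * q) ^ 2 := by gcongr; linarith
      _ ≤ _ := by nlinarith [sq_nonneg (‖z‖ * p - q)]
  replace hbound : ‖star (v + d * z)‖ ≤ √(1 + ‖z‖ ^ 2) := hbound
  rw [norm_star] at hbound
  calc ‖v + d * z‖ ^ 2 ≤ √(1 + ‖z‖ ^ 2) ^ 2 := by gcongr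
    _ = _ := Real.sq_sqrt (by positivity)

/-- Moving `v` in the direction `dz` changes the norm only to second order. Since `φ` is already
maximal at `v`, its first-order change `φ(dz)` must vanish; then take `z = dy`. -/
theorem apply_mul_star_mul {v : M.toStarSubalgebra} (hv : ‖v‖ ≤ 1) (h : φ v = (‖φ‖ : ℂ))
    (y : M.toStarSubalgebra) : φ (v * (star v * y)) = φ y := by
  have hd : 0 ≤ 1 - v * star v := by
    have := star_mul_self_le_one (x := star v) (by rwa [norm_star])
    rw [star_star] at this
    exact sub_nonneg.2 this
  have key : ∀ z, φ (sqrt (1 - v * star v) * z) = 0 := by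
    intro z
    set d := sqrt (1 - v * star v) with hd_def
    by_contra hne
    set b := φ (d * z) with hb
    have hb0 : 0 < ‖b‖ := norm_pos_iff.2 hne
    have hφ0 : 0 < ‖φ‖ := by
      rcases (norm_nonneg φ).eq_or_lt with h0 | h0
      · rw [norm_eq_zero.1 h0.symm] at hb
        exact absurd hb hne
      · exact h0
    have h1 : ∀ t : ℝ, 0 ≤ t →
        (‖φ‖ + t * ‖b‖ ^ 2) ^ 2 ≤ ‖φ‖ ^ 2 * (1 + (t * ‖b‖ * ‖z‖) ^ 2) := by
      intro t ht
      set c : ℂ := t * starRingEnd ℂ b with hc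
      have h2 : φ (v + d * (c • z)) = ((‖φ‖ + t * ‖b‖ ^ 2 : ℝ) : ℂ) := by
        rw [mul_smul_comm, map_add, map_smul, h, ← hb, hc, smul_eq_mul, mul_assoc,
          Complex.conj_mul']
        push_cast; ring
      have h3 := φ.le_opNorm (v + d * (c • z))
      rw [h2, Complex.norm_real, Real.norm_of_nonneg (by positivity)] at h3
      have h4 := norm_add_sqrt_mul_sq_le hv (c • z)
      have h5 : ‖c • z‖ = t * ‖b‖ * ‖z‖ := by
        rw [norm_smul, hc, norm_mul, RCLike.norm_conj, Complex.norm_real,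
          Real.norm_of_nonneg ht]
      rw [h5] at h4
      calc _ ≤ (‖φ‖ * ‖v + d * (c • z)‖) ^ 2 := by gcongr
        _ = ‖φ‖ ^ 2 * ‖v + d * (c • z)‖ ^ 2 := by ring
        _ ≤ _ := by gcongr
    -- Small enough that the quadratic term on the right of `h1` cannot compensate the linear gain
    -- on the left.
    set t : ℝ := 1 / (‖φ‖ * (‖z‖ ^ 2 + 1)) with ht
    have ht0 : 0 < t := by positivity
    have htm : t * (‖φ‖ * (‖z‖ ^ 2 + 1)) = 1 := by rw [ht]; field_simp
    have h2 := h1 t ht0.le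
    have h3 : 2 * ‖φ‖ * (t * ‖b‖ ^ 2) ≤ ‖φ‖ * (t * ‖b‖ ^ 2) * (t * (‖φ‖ * ‖z‖ ^ 2)) := by
      nlinarith [sq_nonneg (t * ‖b‖ ^ 2)]
    have h4 : t * (‖φ‖ * ‖z‖ ^ 2) ≤ 1 := by nlinarith
    have h5 : 0 < ‖φ‖ * (t * ‖b‖ ^ 2) := by positivity
    nlinarith
  have h1 := key (sqrt (1 - v * star v) * y)
  rw [← mul_assoc, sqrt_mul_sqrt hd, sub_mul, one_mul, map_sub, sub_eq_zero, mul_assoc] at h1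
  exact h1.symm

theorem norm_lmul_le {v : M.toStarSubalgebra} (hv : ‖v‖ ≤ 1) : ‖lmul v φ‖ ≤ ‖φ‖ := by
  refine ContinuousLinearMap.opNorm_le_bound _ (norm_nonneg _) fun y => ?_
  rw [lmul_apply]
  refine (φ.le_opNorm _).trans (mul_le_mul_of_nonneg_left ((norm_mul_le _ _).trans ?_)
    (norm_nonneg _))
  exact mul_le_of_le_one_left (norm_nonneg _) hv

theorem isPositive_lmul_of_apply_eq_norm {v : M.toStarSubalgebra} (hv : ‖v‖ ≤ 1)
    (h : φ v = (‖φ‖ : ℂ)) : IsPositive (lmul v φ) := by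
  apply isPositive_of_apply_one
  have h1 : lmul v φ 1 = (‖φ‖ : ℂ) := by rw [lmul_apply, mul_one, h]
  have h2 : ‖φ‖ ≤ ‖lmul v φ‖ := by
    have h3 := (lmul v φ).le_opNorm 1
    rw [h1, Complex.norm_real, norm_norm] at h3
    exact h3.trans (mul_le_of_le_one_right (norm_nonneg _) norm_one_le)
  rw [h1, le_antisymm h2 (norm_lmul_le hv)]

theorem lmul_star_lmul_of_apply_eq_norm {v : M.toStarSubalgebra} (hv : ‖v‖ ≤ 1)
    (h : φ v = (‖φ‖ : ℂ)) : lmul (star v) (lmul v φ) = φ := by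
  ext y
  exact apply_mul_star_mul hv h y

/-- Expanding gives `ω((1-w)(1-w)*) ≤ 0`, so Cauchy-Schwarz kills `ω((1-w)y)`. -/
theorem IsPositive.apply_mul_of_apply_eq_one (hω : IsPositive ω) {w : M.toStarSubalgebra}
    (hw : ‖w‖ ≤ 1) (h : ω w = ω 1) (y : M.toStarSubalgebra) : ω (w * y) = ω y := by
  have h1 : ω (star (1 - star w) * (1 - star w)) = 0 := by
    refine le_antisymm ?_ (hω.star_mul_self_nonneg _)
    have h2 : star (1 - star w) * (1 - star w) = 1 - w - star w + w * star w := by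
      simp only [star_sub, star_one, star_star]; noncomm_ring
    have h3 : w * star w ≤ 1 := by
      simpa using star_mul_self_le_one (x := star w) (by rwa [norm_star])
    have h4 := hω.mono h3
    have h5 : star (ω 1) = ω 1 := by rw [← hω.isHermitian, star_one]
    rw [h2, map_add, map_sub, map_sub, hω.isHermitian, h, h5]
    simpa using h4
  have h2 := hω.apply_star_mul_eq_zero h1 y
  rw [star_sub, star_one, star_star, sub_mul, one_mul, map_sub, sub_eq_zero] at h2
  exact h2.symm

/-- Uniqueness of the absolute value: `ω' = (u u'*) ω` with `u u'*` a contraction, and `ω(1) = ‖φ‖ =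
ω'(1)`, so the factor `u u'*` acts trivially. -/
theorem IsPositive.eq_of_lmul_eq (hω : IsPositive ω) (hω' : IsPositive ω')
    {u u' : M.toStarSubalgebra} (hu : ‖u‖ ≤ 1) (hu' : ‖u'‖ ≤ 1) (h : φ = lmul u ω)
    (h' : φ = lmul u' ω') (k : ω = lmul (star u) φ) (k' : ω' = lmul (star u') φ) : ω = ω' := by
  have e1 : ω 1 = ω' 1 := by
    rw [hω.apply_one, hω'.apply_one]
    have h1 : ‖φ‖ ≤ ‖ω‖ := h ▸ norm_lmul_le hu
    have h2 : ‖φ‖ ≤ ‖ω'‖ := h' ▸ norm_lmul_le hu'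
    have h3 : ‖ω‖ ≤ ‖φ‖ := by
      conv_lhs => rw [k]
      exact norm_lmul_le (by rwa [norm_star])
    have h4 : ‖ω'‖ ≤ ‖φ‖ := by
      conv_lhs => rw [k']
      exact norm_lmul_le (by rwa [norm_star])
    rw [le_antisymm h3 h1, le_antisymm h4 h2]
  have e2 : ∀ y, ω' y = ω (u * star u' * y) := fun y => by
    rw [k', h]; simp [mul_assoc]
  ext y
  rw [e2, hω.apply_mul_of_apply_eq_one]
  · refine (norm_mul_le _ _).trans (mul_le_one₀ hu (norm_nonneg _) ?_)
    rwa [norm_star]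
  · rw [e1, e2, mul_one]

end VonNeumannAlgebra

/-! ### Positive normal functionals as sums of vector functionals. -/

namespace VonNeumannAlgebra

section Sesquilinear

variable {E K : Type*} [AddCommGroup E] [Module ℂ E] [NormedAddCommGroup K]
  [InnerProductSpace ℂ K]

/-- The form is bounded for the seminorm `‖e x‖`, so it extends by density in each variable and
Riesz representation applies. -/
theorem exists_inner_apply_eq_of_denseRange [CompleteSpace K] {e : E →ₗ[ℂ] K} (he : DenseRange e)
    (B : E →ₗ⋆[ℂ] E →ₗ[ℂ] ℂ) (hB : ∀ x y, ‖B x y‖ ≤ ‖e x‖ * ‖e y‖) :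
    ∃ t : K →L[ℂ] K, ∀ x y, ⟪t (e x), e y⟫_ℂ = B x y := by
  have h1 : ∀ x y, (B x).extendOfNorm e (e y) = B x y := fun x y =>
    LinearMap.extendOfNorm_eq he ⟨‖e x‖, hB x⟩ y
  have hext : ∀ f g : K →L[ℂ] ℂ, (∀ y, f (e y) = g (e y)) → f = g := fun f g h =>
    DFunLike.coe_injective (he.equalizer f.continuous g.continuous (funext h))
  let f : E →ₗ⋆[ℂ] (K →L[ℂ] ℂ) :=
    { toFun := fun x => (B x).extendOfNorm e
      map_add' := fun x x' => hext _ _ fun y => (h1 _ _).trans (by simp [h1])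
      map_smul' := fun c x => hext _ _ fun y => (h1 _ _).trans (by simp [h1]) }
  have hf : ∀ x, ‖f x‖ ≤ 1 * ‖e x‖ := fun x => by
    rw [one_mul]
    exact LinearMap.opNorm_extendOfNorm_le he (norm_nonneg _) (hB x)
  refine ⟨InnerProductSpace.continuousLinearMapOfBilin (f.extendOfNorm e), fun x y => ?_⟩
  rw [InnerProductSpace.continuousLinearMapOfBilin_apply, LinearMap.extendOfNorm_eq he ⟨1, hf⟩]
  exact h1 x y

theorem isPositive_of_denseRange {E : Type*} {e : E → K} (he : DenseRange e) {t : K →L[ℂ] K}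
    (ht : ∀ x, 0 ≤ ⟪t (e x), e x⟫_ℂ) : t.IsPositive := by
  rw [ContinuousLinearMap.isPositive_iff_complex]
  intro k
  have h : 0 ≤ (⟪t k, k⟫_ℂ).re ∧ (⟪t k, k⟫_ℂ).im = 0 := by
    refine he.induction_on (p := fun k => 0 ≤ (⟪t k, k⟫_ℂ).re ∧ (⟪t k, k⟫_ℂ).im = 0) k ?_ ?_
    · refine IsClosed.inter (s₁ := {k | 0 ≤ (⟪t k, k⟫_ℂ).re}) (s₂ := {k | (⟪t k, k⟫_ℂ).im = 0})
        (isClosed_le (by fun_prop) (by fun_prop)) (isClosed_eq (by fun_prop) (by fun_prop))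
    · intro x
      have := Complex.nonneg_iff.1 (ht x)
      exact ⟨this.1, this.2.symm⟩
  exact ⟨Complex.ext (by simp) (by simp [h.2]), h.1⟩

theorem commute_of_denseRange {E : Type*} {e : E → K} (he : DenseRange e) {t a : K →L[ℂ] K}
    (h : ∀ x y, ⟪t (a (e x)), e y⟫_ℂ = ⟪a (t (e x)), e y⟫_ℂ) : Commute t a := by
  have h1 : ∀ x, t (a (e x)) = a (t (e x)) := fun x => he.eq_of_inner_left ℂ (h x)
  have h2 : (fun k => t (a k)) = fun k => a (t k) :=
    he.equalizer (by fun_prop) (by fun_prop) (funext h1)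
  exact ContinuousLinearMap.ext fun k => congrFun h2 k

theorem inner_sqrt_apply [CompleteSpace K] {t a : K →L[ℂ] K} (ht : 0 ≤ t) (hc : Commute t a) (k : K) :
    ⟪CFC.sqrt t k, a (CFC.sqrt t k)⟫_ℂ = ⟪t k, a k⟫_ℂ := by
  have hrr : CFC.sqrt t * CFC.sqrt t = t := CFC.sqrt_mul_sqrt_self t ht
  have hrs : star (CFC.sqrt t) = CFC.sqrt t := (CFC.sqrt_nonneg t).isSelfAdjoint.star_eq
  have hrc : Commute (CFC.sqrt t) a := Commute.cfcₙ_nnreal hc NNReal.sqrt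
  have h1 : a (CFC.sqrt t k) = CFC.sqrt t (a k) := congrArg (fun f => f k) hrc.symm.eq
  have h2 : t k = CFC.sqrt t (CFC.sqrt t k) := congrArg (fun f => f k) hrr.symm
  rw [h1, ← inner_star_apply, hrs, ← h2]

theorem denseRange_coprod_orthogonal [CompleteSpace K] (e : E →ₗ[ℂ] K) :
    DenseRange (e.coprod (LinearMap.range e)ᗮ.subtype) := by
  have h : (LinearMap.range (e.coprod (LinearMap.range e)ᗮ.subtype)).topologicalClosure = ⊤ := by
    rw [Submodule.topologicalClosure_eq_top_iff, LinearMap.range_coprod, Submodule.range_subtype,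
      ← Submodule.inf_orthogonal, Submodule.inf_orthogonal_eq_bot]
  have h2 := (Submodule.dense_iff_topologicalClosure_eq_top).2 h
  rwa [LinearMap.coe_range] at h2

end Sesquilinear

variable {H : Type*} [NormedAddCommGroup H] [InnerProductSpace ℂ H] [CompleteSpace H]
variable {M : VonNeumannAlgebra H} {φ ω : Functional M}

section Representation

variable {K : Type*} [NormedAddCommGroup K] [InnerProductSpace ℂ K] [CompleteSpace K]
  (π : M.toStarSubalgebra →⋆ₐ[ℂ] (K →L[ℂ] K))

theorem inner_map_star (x : M.toStarSubalgebra) (k l : K) :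
    ⟪π (star x) l, k⟫_ℂ = ⟪l, π x k⟫_ℂ := by
  rw [map_star, inner_star_apply]

theorem map_mul_apply' (x y : M.toStarSubalgebra) (k : K) : π (x * y) k = π x (π y k) := by
  rw [map_mul]; rfl

/-- The vector is `(ξ + η)/2`, because `Re ⟪k, l⟫ ≤ ‖(k + l)/2‖²`. -/
theorem exists_apply_le_norm_sq {ξ η : K} (h : ∀ x, ω x = ⟪η, π x ξ⟫_ℂ) :
    ∃ ζ : K, ∀ x, (ω (star x * x)).re ≤ ‖π x ζ‖ ^ 2 := by
  refine ⟨(2⁻¹ : ℂ) • (ξ + η), fun x => ?_⟩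
  have h1 : ω (star x * x) = ⟪π x η, π x ξ⟫_ℂ := by
    rw [h, map_mul_apply', ← inner_map_star, star_star]
  rw [h1, map_smul, map_add, norm_smul, mul_pow]
  have h2 := @norm_add_sq ℂ _ _ _ _ (π x η) (π x ξ)
  have h3 := @norm_sub_sq ℂ _ _ _ _ (π x η) (π x ξ)
  rw [add_comm (π x ξ), h2]
  have h4 := sq_nonneg ‖π x η - π x ξ‖
  rw [h3] at h4
  simp only [norm_inv, RCLike.norm_ofNat, RCLike.re_to_complex] at *
  linarith

set_option maxHeartbeats 1000000 in
-- A Radon-Nikodym theorem: the form `ω(x*y)` is dominated by the vector form of `ζ`, and `ω((zx)*y)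
-- = ω(x*(z*y))` puts its density `t` in the commutant of the representation.
theorem exists_commute_of_apply_le (hp : IsPositive ω) {ζ : K}
    (hdom : ∀ x, (ω (star x * x)).re ≤ ‖π x ζ‖ ^ 2) :
    ∃ t : K →L[ℂ] K, 0 ≤ t ∧ (∀ x, Commute t (π x)) ∧ ∀ x, ⟪t ζ, π x ζ⟫_ℂ = ω x := by
  let e : M.toStarSubalgebra →ₗ[ℂ] K :=
    { toFun := fun x => π x ζ
      map_add' := fun x y => by rw [map_add]; rfl
      map_smul' := fun c x => by rw [map_smul]; rfl }
  -- The cyclic vectors `π x ζ` need not be dense; adjoining the orthogonal complement, on which the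
  -- form is zero, defines `t` on all of `K`.
  let B : (M.toStarSubalgebra × (LinearMap.range e)ᗮ) →ₗ⋆[ℂ]
      (M.toStarSubalgebra × (LinearMap.range e)ᗮ) →ₗ[ℂ] ℂ :=
    LinearMap.mk₂'ₛₗ (starRingEnd ℂ) (RingHom.id ℂ) (fun x y => ω (star x.1 * y.1))
      (fun x y z => by simp [add_mul]) (fun c x y => by simp)
      (fun x y z => by simp [mul_add]) (fun c x y => by simp)
  let e' := e.coprod (LinearMap.range e)ᗮ.subtype
  have he' : DenseRange e' := denseRange_coprod_orthogonal e
  have he'_apply : ∀ x, e' x = e x.1 + x.2 := fun x => rfl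
  have hB_apply : ∀ x y, B x y = ω (star x.1 * y.1) := fun x y => rfl
  have he_mul : ∀ x y, e (x * y) = π x (e y) := fun x y => map_mul_apply' π x y ζ
  have he_one : e 1 = ζ := by
    change π 1 ζ = ζ
    rw [map_one]; rfl
  have he_apply : ∀ x, e x = π x ζ := fun x => rfl
  clear_value e' B
  have hle : ∀ x, ‖e x.1‖ ≤ ‖e' x‖ := by
    intro x
    have h0 : ⟪e x.1, (x.2 : K)⟫_ℂ = 0 :=
      Submodule.inner_right_of_mem_orthogonal (LinearMap.mem_range_self e x.1) x.2.2
    have h1 := norm_add_sq_eq_norm_sq_add_norm_sq_of_inner_eq_zero _ _ h0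
    rw [he'_apply]
    nlinarith [norm_nonneg (e x.1), norm_nonneg (e x.1 + x.2), norm_nonneg (x.2 : K)]
  have hB : ∀ x y, ‖B x y‖ ≤ ‖e' x‖ * ‖e' y‖ := by
    intro x y
    refine le_trans ?_ (mul_le_mul (hle x) (hle y) (norm_nonneg _) (norm_nonneg _))
    have h1 := hp.norm_sq_le x.1 y.1
    have h2 := (Complex.nonneg_iff.1 (hp.star_mul_self_nonneg y.1)).1
    have h3 : ‖ω (star x.1 * y.1)‖ ^ 2 ≤ (‖e x.1‖ * ‖e y.1‖) ^ 2 := by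
      rw [mul_pow]
      exact h1.trans (mul_le_mul (hdom x.1) (hdom y.1) h2 (sq_nonneg _))
    rw [hB_apply]
    exact (sq_le_sq₀ (norm_nonneg _) (by positivity)).1 h3
  obtain ⟨t, ht⟩ := exists_inner_apply_eq_of_denseRange he' B hB
  have htp : 0 ≤ t := (ContinuousLinearMap.nonneg_iff_isPositive t).2
    (isPositive_of_denseRange he' fun x => by
      rw [ht, hB_apply]; exact hp.star_mul_self_nonneg x.1)
  have hinv : ∀ (z : M.toStarSubalgebra) (x), ∃ k, π z (e' x) = e' (z * x.1, k) := by
    intro z x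
    refine ⟨⟨π z x.2, ?_⟩, ?_⟩
    · rw [Submodule.mem_orthogonal]
      rintro _ ⟨y, rfl⟩
      rw [← inner_map_star, ← he_mul]
      exact Submodule.inner_right_of_mem_orthogonal (LinearMap.mem_range_self e _) x.2.2
    · rw [he'_apply, he'_apply, map_add, he_mul]
  refine ⟨t, htp, fun z => commute_of_denseRange he' fun x y => ?_, fun x => ?_⟩
  · have h2 := inner_map_star π (star z) (e' y) (t (e' x))
    rw [star_star] at h2
    obtain ⟨k, hk⟩ := hinv z x
    obtain ⟨l, hl⟩ := hinv (star z) y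
    rw [h2, hk, hl, ht, ht, hB_apply, hB_apply, star_mul, mul_assoc]
  · have h1 := ht (1, 0) (x, 0)
    rw [he'_apply, he'_apply, hB_apply] at h1
    simpa [he_one, he_apply] using h1

/-- The root of the density commutes with the representation, so half of `t` moves to each side of
the inner product. -/
theorem IsPositive.exists_eq_inner (hp : IsPositive ω) {ξ η : K}
    (h : ∀ x, ω x = ⟪η, π x ξ⟫_ℂ) : ∃ ζ : K, ∀ x, ω x = ⟪ζ, π x ζ⟫_ℂ := by
  obtain ⟨ζ, h⟩ := exists_apply_le_norm_sq π h
  obtain ⟨t, ht, hc, h'⟩ := exists_commute_of_apply_le π hp h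
  exact ⟨CFC.sqrt t ζ, fun x => by rw [← h', ← inner_sqrt_apply ht (hc x)]⟩

end Representation

variable (M) in
/-- The diagonal action of a von Neumann algebra on the Hilbert sum of countably many copies of
the underlying space. -/
noncomputable def amplification :
    M.toStarSubalgebra →⋆ₐ[ℂ] (lp (fun _ : ℕ => H) 2 →L[ℂ] lp (fun _ : ℕ => H) 2) where
  toFun x := lp.mapCLM 2 (fun _ => (x : H →L[ℂ] H)) (norm_nonneg x) (fun _ => le_rfl)
  map_one' := by ext k n; rfl
  map_mul' x y := by ext k n; rfl
  map_zero' := by ext k n; rfl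
  map_add' x y := by ext k n; rfl
  commutes' c := by ext k n; rfl
  map_star' x := by
    rw [ContinuousLinearMap.star_eq_adjoint, ContinuousLinearMap.eq_adjoint_iff]
    intro k l
    rw [lp.inner_eq_tsum, lp.inner_eq_tsum]
    exact tsum_congr fun n => inner_star_apply (x : H →L[ℂ] H) _ _

theorem IsNormal.exists_eq_inner_amplification (hφ : IsNormal φ) :
    ∃ ξ η : lp (fun _ : ℕ => H) 2, ∀ x, φ x = ⟪η, amplification M x ξ⟫_ℂ := by
  obtain ⟨ξ, η, hξ, hη, h⟩ := hφ
  have hm : ∀ {ζ : ℕ → H}, (Summable fun n => ‖ζ n‖ ^ 2) → Memℓp ζ 2 := fun hζ =>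
    memℓp_gen (by simpa using hζ)
  refine ⟨⟨ξ, hm hξ⟩, ⟨η, hm hη⟩, fun x => ?_⟩
  rw [lp.inner_eq_tsum, ← (h x).tsum_eq]
  rfl

theorem IsPositive.exists_hasSum (hp : IsPositive ω) (hω : IsNormal ω) :
    ∃ ζ : ℕ → H, ∀ x : M.toStarSubalgebra,
      HasSum (fun n => ⟪ζ n, (x : H →L[ℂ] H) (ζ n)⟫_ℂ) (ω x) := by
  obtain ⟨ξ, η, h⟩ := hω.exists_eq_inner_amplification
  obtain ⟨ζ, h'⟩ := hp.exists_eq_inner (amplification M) h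
  refine ⟨ζ, fun x => ?_⟩
  rw [h']
  exact lp.hasSum_inner ζ (amplification M x ζ)

end VonNeumannAlgebra

/-! ### Support projections and absolute values. -/

namespace VonNeumannAlgebra

variable {H : Type*} [NormedAddCommGroup H] [InnerProductSpace ℂ H] [CompleteSpace H]
variable {M : VonNeumannAlgebra H} {φ ψ ω : Functional M}

/-- The projection onto the closed span of `M'S`. This space is invariant under the commutant, so
the projection is in `M`; an element of `M` vanishing on `S` vanishes on `M'S`. -/
theorem exists_projection_eq_span (S : Set H) :
    ∃ s : M.toStarSubalgebra, IsStarProjection s ∧ (∀ ξ ∈ S, (s : H →L[ℂ] H) ξ = ξ) ∧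
      ∀ x : M.toStarSubalgebra, (∀ ξ ∈ S, (x : H →L[ℂ] H) ξ = 0) → x * s = 0 := by
  let V₀ : Submodule ℂ H := Submodule.span ℂ {ξ | ∃ y ∈ M.commutant, ∃ ζ ∈ S, y ζ = ξ}
  let V := V₀.topologicalClosure
  have hproj : IsStarProjection V.starProjection :=
    isStarProjection_starProjection
  have hmem : V.starProjection ∈ M := by
    rw [IsStarProjection.mem_iff hproj]
    intro y hy
    have h1 : V₀ ≤ V₀.comap (y : H →ₗ[ℂ] H) := by
      refine Submodule.span_le.2 ?_
      rintro _ ⟨z, hz, ζ, hζ, rfl⟩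
      exact Submodule.subset_span ⟨y * z, mul_mem hy hz, ζ, hζ, rfl⟩
    have h2 : V ≤ V.comap (y : H →ₗ[ℂ] H) := by
      refine Submodule.topologicalClosure_minimal _ (h1.trans (Submodule.comap_mono
        V₀.le_topologicalClosure)) ?_
      exact V₀.isClosed_topologicalClosure.preimage y.continuous
    have h3 : (V.starProjection : H →L[ℂ] H).range = V := Submodule.range_starProjection V
    rw [h3]
    exact h2
  refine ⟨⟨V.starProjection, hmem⟩, ?_, fun ξ hξ => ?_, fun x hx => ?_⟩
  · exact ⟨Subtype.ext hproj.isIdempotentElem, Subtype.ext hproj.isSelfAdjoint⟩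
  · exact Submodule.starProjection_eq_self_iff.2 (V₀.le_topologicalClosure
      (Submodule.subset_span ⟨1, one_mem _, ξ, hξ, rfl⟩))
  · have h1 : V₀ ≤ LinearMap.ker ((x : H →L[ℂ] H) : H →ₗ[ℂ] H) := by
      refine Submodule.span_le.2 ?_
      rintro _ ⟨z, hz, ζ, hζ, rfl⟩
      have h2 : (x : H →L[ℂ] H) * z = z * (x : H →L[ℂ] H) := mem_commutant_iff.1 hz _ x.2
      have h3 : (x : H →L[ℂ] H) (z ζ) = z ((x : H →L[ℂ] H) ζ) := congrArg (fun f => f ζ) h2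
      rw [hx ζ hζ, map_zero] at h3
      exact h3
    have h2 : V ≤ LinearMap.ker ((x : H →L[ℂ] H) : H →ₗ[ℂ] H) :=
      Submodule.topologicalClosure_minimal _ h1 (ContinuousLinearMap.isClosed_ker _)
    refine Subtype.ext (ContinuousLinearMap.ext fun ξ => ?_)
    exact h2 (V.starProjection_apply_mem ξ)

/-- As `ω(x*x) = ∑ ‖x ζₙ‖²`, its vanishing means that `x` kills every `ζₙ`, hence the projection
they generate. -/
theorem IsPositive.exists_isSupport (hp : IsPositive ω) (hω : IsNormal ω) :
    ∃ s : M.toStarSubalgebra, IsSupport ω s ∧ ∀ x, ω (star x * x) = 0 → x * s = 0 := by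
  obtain ⟨ζ, h⟩ := hp.exists_hasSum hω
  obtain ⟨s, hs, hs1, hs2⟩ := exists_projection_eq_span (M := M) (Set.range ζ)
  have hfaith : ∀ x, ω (star x * x) = 0 → x * s = 0 := by
    intro x hx
    refine hs2 x ?_
    rintro _ ⟨n, rfl⟩
    have h1 := h (star x * x)
    rw [hx] at h1
    have h2 : ∀ n, ⟪ζ n, ((star x * x : M.toStarSubalgebra) : H →L[ℂ] H) (ζ n)⟫_ℂ =
        ((‖(x : H →L[ℂ] H) (ζ n)‖ ^ 2 : ℝ) : ℂ) := by
      intro n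
      have h3 : ⟪(star (star (x : H →L[ℂ] H))) (ζ n), (x : H →L[ℂ] H) (ζ n)⟫_ℂ =
        ⟪ζ n, (star (x : H →L[ℂ] H)) ((x : H →L[ℂ] H) (ζ n))⟫_ℂ := inner_star_apply _ _ _
      rw [star_star, inner_self_eq_norm_sq_to_K] at h3
      refine h3.symm.trans ?_
      push_cast; rfl
    simp_rw [h2] at h1
    rw [← Complex.ofReal_zero, Complex.hasSum_ofReal] at h1
    have h4 := congrFun ((hasSum_zero_iff_of_nonneg fun n => sq_nonneg _).1 h1) n
    simpa using h4
  refine ⟨s, ⟨hs, ?_, fun q hq hq1 => ?_⟩, hfaith⟩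
  · refine (h (1 - s)).unique ?_
    have h1 : ∀ n, ((1 - s : M.toStarSubalgebra) : H →L[ℂ] H) (ζ n) = 0 := by
      intro n
      change ζ n - (s : H →L[ℂ] H) (ζ n) = 0
      rw [hs1 _ (Set.mem_range_self n), sub_self]
    simp_rw [h1, inner_zero_right]
    exact hasSum_zero
  · have h1 : star (1 - q) * (1 - q) = 1 - q := by
      rw [hq.one_sub.isSelfAdjoint.star_eq, hq.one_sub.isIdempotentElem.eq]
    have h2 := hfaith (1 - q) (by rw [h1, hq1])
    have h3 : q * s = s := by
      rw [sub_mul, one_mul, sub_eq_zero] at h2; exact h2.symm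
    have h4 : s * q = s := by
      have := congrArg star h3
      rwa [star_mul, hs.isSelfAdjoint.star_eq, hq.isSelfAdjoint.star_eq] at this
    have h5 := star_left_conjugate_nonneg hq.nonneg (1 - s)
    rw [hs.one_sub.isSelfAdjoint.star_eq] at h5
    have h6 : (1 - s) * q * (1 - s) = q - s := by
      rw [sub_mul, one_mul, h4, mul_sub, mul_one, sub_mul, h3, hs.isIdempotentElem.eq]
      abel
    rw [h6] at h5
    exact sub_nonneg.1 h5

theorem IsPositive.apply_projection_mul (hp : IsPositive ω) {s : M.toStarSubalgebra}
    (hs : IsStarProjection s) (h : ω (1 - s) = 0) (y : M.toStarSubalgebra) :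
    ω (s * y) = ω y :=
  hp.apply_mul_of_apply_eq_one (norm_le_one_of_nonneg hs.nonneg hs.le_one)
    (by rw [map_sub, sub_eq_zero] at h; exact h.symm) y

theorem IsNormal.exists_isAbsoluteValue (hφ : IsNormal φ) : ∃ ω, IsAbsoluteValue φ ω := by
  obtain ⟨v, hv, hφv⟩ := hφ.exists_apply_eq_norm
  have hp := isPositive_lmul_of_apply_eq_norm hv hφv
  obtain ⟨s, hs, hfaith⟩ := hp.exists_isSupport (hφ.left_mul v)
  -- Cutting `v*` down by the support makes it a partial isometry: `ω(1 - v*v) = 0` forces `v*v s =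
  -- s`.
  refine ⟨lmul v φ, ⟨hφ.left_mul v, hp⟩, s * star v, ?_, ?_⟩
  · have h1 : 0 ≤ 1 - star v * v := sub_nonneg.2 (star_mul_self_le_one hv)
    have h2 := hfaith (sqrt (1 - star v * v)) (by
      rw [star_sqrt, sqrt_mul_sqrt h1, map_sub, sub_eq_zero, lmul_apply, lmul_apply,
        apply_mul_star_mul hv hφv, mul_one])
    have h3 : (1 - star v * v) * s = 0 := by
      rw [← sqrt_mul_sqrt h1, mul_assoc, h2, mul_zero]
    have h4 : star v * v * s = s := by
      rw [sub_mul, one_mul, sub_eq_zero] at h3; exact h3.symm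
    have h5 : s * star v * star (s * star v) = s := by
      rw [star_mul, star_star, hs.1.isSelfAdjoint.star_eq]
      calc s * star v * (v * s) = s * (star v * v * s) := by simp only [mul_assoc]
        _ = s := by rw [h4, hs.1.isIdempotentElem.eq]
    rwa [h5]
  · ext y
    rw [lmul_apply, mul_assoc, hp.apply_projection_mul hs.1 hs.2.1, lmul_apply,
      apply_mul_star_mul hv hφv]

theorem IsAbsoluteValue.exists_lmul (h : IsAbsoluteValue φ ω) :
    ∃ u : M.toStarSubalgebra, ‖u‖ ≤ 1 ∧ φ = lmul u ω ∧ ω = lmul (star u) φ := by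
  obtain ⟨⟨-, hp⟩, u, hs, hu⟩ := h
  refine ⟨u, ?_, hu, ?_⟩
  · rw [← norm_star]
    refine norm_le_one_of_star_mul_self ?_
    rw [star_star]
    exact hs.1.le_one
  · ext y
    rw [lmul_apply, hu, lmul_apply, ← mul_assoc, hp.apply_projection_mul hs.1 hs.2.1]

theorem absoluteValue_spec (hφ : IsNormal φ) : IsAbsoluteValue φ (absoluteValue φ) :=
  Classical.epsilon_spec hφ.exists_isAbsoluteValue

theorem absoluteValue_eq (hφ : IsNormal φ) (hp : IsPositive ω) {u : M.toStarSubalgebra}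
    (hu : ‖u‖ ≤ 1) (h : φ = lmul u ω) (h' : ω = lmul (star u) φ) : absoluteValue φ = ω := by
  have h1 := absoluteValue_spec hφ
  obtain ⟨v, hv, h2, h3⟩ := h1.exists_lmul
  exact h1.1.2.eq_of_lmul_eq hp hv hu h2 h h3 h'

theorem exists_isSelfAdjoint_apply_eq_norm (hφ : φ ∈ M.hermitianPredual) :
    ∃ v : M.toStarSubalgebra, star v = v ∧ ‖v‖ ≤ 1 ∧ φ v = (‖φ‖ : ℂ) := by
  obtain ⟨v, hv, h⟩ := hφ.1.exists_apply_eq_norm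
  refine ⟨(2⁻¹ : ℂ) • (v + star v), ?_, ?_, ?_⟩
  · rw [star_smul, star_add, star_star, add_comm]; simp
  · rw [norm_smul, norm_inv, RCLike.norm_ofNat]
    have := norm_add_le v (star v)
    rw [norm_star] at this
    linarith
  · rw [map_smul, map_add, hφ.2, h, Complex.star_def, Complex.conj_ofReal, smul_eq_mul]
    ring

/-! ### Jordan decomposition from a self-adjoint norming element. -/

section Jordan

variable {v : M.toStarSubalgebra}

theorem IsPositive.add_lmul_nonneg (hp : IsPositive ω) (hvs : star v = v)
    (h : ∀ y, ω (v * (v * y)) = ω y) (hc : ∀ y, ω (v * y) = ω (y * v)) :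
    IsPositive (ω + lmul v ω) := by
  intro x hx
  have h1 := hp _ (star_left_conjugate_nonneg hx (1 + v))
  -- Here `v` behaves under `ω` like a symmetry commuting with every `x`.
  have h2 : ω (star (1 + v) * x * (1 + v)) = 2 * (ω + lmul v ω) x := by
    have h3 : ω (v * x * v) = ω x := by rw [← hc, h]
    rw [star_add, star_one, hvs, mul_add, mul_one, add_mul, one_mul, add_mul, map_add, map_add,
      map_add, h3, ← hc, add_apply, lmul_apply]
    ring
  rw [h2] at h1
  have h3 : (0 : ℂ) ≤ 2⁻¹ := by rw [Complex.nonneg_iff]; norm_num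
  simpa using mul_nonneg h3 h1

theorem isPositivePart_of_apply_eq_norm (hφ : φ ∈ M.hermitianPredual) (hvs : star v = v)
    (hv : ‖v‖ ≤ 1) (h : φ v = (‖φ‖ : ℂ)) :
    IsPositivePart φ ((2⁻¹ : ℂ) • (lmul v φ + φ)) := by
  have hp := isPositive_lmul_of_apply_eq_norm hv h
  have hvv : ∀ y, φ (v * (v * y)) = φ y := fun y => by
    simpa [hvs] using apply_mul_star_mul hv h y
  have h1 : ∀ y, lmul v φ (v * (v * y)) = lmul v φ y := fun y => hvv _
  have h2 : ∀ y, lmul v φ (v * y) = lmul v φ (y * v) := by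
    intro y
    have h3 := hp.isHermitian (v * star y)
    rw [star_mul, star_star, hvs] at h3
    rw [h3, lmul_apply, lmul_apply, hvv, hvv, hφ.2, star_star]
  have h3 : lmul v (lmul v φ) = φ := ContinuousLinearMap.ext hvv
  have h4 : lmul (-v) (lmul v φ) = -φ := by
    ext y
    rw [lmul_apply, neg_mul, map_neg, lmul_apply, hvv]; rfl
  have hpos1 := hp.add_lmul_nonneg hvs h1 h2
  have hpos2 := hp.add_lmul_nonneg (v := -v) (by rw [star_neg, hvs])
    (fun y => by rw [neg_mul, neg_mul, mul_neg, neg_neg, h1]) (fun y => by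
      rw [neg_mul, mul_neg, map_neg, map_neg, h2])
  rw [h3] at hpos1
  rw [h4, ← sub_eq_add_neg] at hpos2
  have h0 : (0 : ℂ) ≤ 2⁻¹ := by rw [Complex.nonneg_iff]; norm_num
  have hhalf : ∀ {ρ : Functional M}, IsPositive ρ → IsPositive ((2⁻¹ : ℂ) • ρ) :=
    fun hρ x hx => mul_nonneg h0 (hρ x hx)
  refine ⟨⟨((hφ.1.left_mul v).add hφ.1).smul _, hhalf hpos1⟩, (2⁻¹ : ℂ) • (lmul v φ - φ),
    ⟨((hφ.1.left_mul v).sub hφ.1).smul _, hhalf hpos2⟩, ?_, ?_⟩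
  · ext y
    simp only [sub_apply, smul_apply,
      add_apply, smul_eq_mul]
    ring
  · apply Complex.ofReal_injective
    rw [Complex.ofReal_add, ← (hhalf hpos1).apply_one, ← (hhalf hpos2).apply_one, ← h]
    simp only [sub_apply, smul_apply,
      add_apply, smul_eq_mul, lmul_apply, mul_one]
    ring

/-- Additivity of the norms forces `ψ(1 - v) = 0 = χ(1 + v)`, so `vψ = ψ` and `vχ = -χ`, which
recovers `ψ` from `φ` and `v`. -/
theorem IsPositivePart.eq_of_apply_eq_norm (h : IsPositivePart φ ψ) (hvs : star v = v)
    (hv : ‖v‖ ≤ 1) (hφv : φ v = (‖φ‖ : ℂ)) : ψ = (2⁻¹ : ℂ) • (lmul v φ + φ) := by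
  obtain ⟨⟨-, hψ⟩, χ, ⟨-, hχ⟩, rfl, hn⟩ := h
  have hv1 := one_sub_nonneg_of_norm_le_one hvs hv
  have hv2 : 0 ≤ 1 - -v := one_sub_nonneg_of_norm_le_one (by rw [IsSelfAdjoint, star_neg, hvs])
    (by rwa [norm_neg])
  have h1 := hψ _ hv1
  have h2 := hχ _ hv2
  have h3 : ψ (1 - v) + χ (1 - -v) = 0 := by
    rw [hn, Complex.ofReal_add, ← hψ.apply_one, ← hχ.apply_one] at hφv
    rw [map_sub, map_sub, map_neg]
    rw [sub_apply] at hφv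
    linear_combination -hφv
  have h4 := (add_eq_zero_iff_of_nonneg h1 h2).1 h3
  have h5 := hψ.apply_mul_of_apply_eq_one hv (by
    have := h4.1; rw [map_sub, sub_eq_zero] at this; exact this.symm)
  have h6 := hχ.apply_mul_of_apply_eq_one (w := -v) (by rwa [norm_neg]) (by
    have := h4.2; rw [map_sub, sub_eq_zero] at this; exact this.symm)
  ext y
  have h7 := h6 y
  rw [neg_mul, map_neg] at h7
  simp only [sub_apply, smul_apply,
    add_apply, smul_eq_mul, lmul_apply]
  rw [h5 y, ← h7]
  ring

theorem positivePart_eq_of_apply_eq_norm (hφ : φ ∈ M.hermitianPredual) (hvs : star v = v)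
    (hv : ‖v‖ ≤ 1) (h : φ v = (‖φ‖ : ℂ)) : positivePart φ = (2⁻¹ : ℂ) • (lmul v φ + φ) :=
  IsPositivePart.eq_of_apply_eq_norm
    (Classical.epsilon_spec ⟨_, isPositivePart_of_apply_eq_norm hφ hvs hv h⟩) hvs hv h

theorem absoluteValue_eq_of_apply_eq_norm (hφ : IsNormal φ) (hvs : star v = v)
    (hv : ‖v‖ ≤ 1) (h : φ v = (‖φ‖ : ℂ)) : absoluteValue φ = lmul v φ := by
  have h1 := lmul_star_lmul_of_apply_eq_norm hv h
  rw [hvs] at h1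
  exact absoluteValue_eq hφ (isPositive_lmul_of_apply_eq_norm hv h) hv h1.symm (by rw [hvs])

end Jordan

theorem isPositivePart_positivePart (hφ : φ ∈ M.hermitianPredual) :
    IsPositivePart φ (positivePart φ) := by
  obtain ⟨v, hvs, hv, h⟩ := exists_isSelfAdjoint_apply_eq_norm hφ
  exact Classical.epsilon_spec ⟨_, isPositivePart_of_apply_eq_norm hφ hvs hv h⟩

theorem IsPositivePart.eq_positivePart (hφ : φ ∈ M.hermitianPredual) (h : IsPositivePart φ ψ) :
    positivePart φ = ψ := by
  obtain ⟨v, hvs, hv, h'⟩ := exists_isSelfAdjoint_apply_eq_norm hφ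
  rw [positivePart_eq_of_apply_eq_norm hφ hvs hv h', h.eq_of_apply_eq_norm hvs hv h']

theorem absoluteValue_apply (hφ : φ ∈ M.hermitianPredual) (x : M.toStarSubalgebra) :
    absoluteValue φ x = 2 * positivePart φ x - φ x := by
  obtain ⟨v, hvs, hv, h⟩ := exists_isSelfAdjoint_apply_eq_norm hφ
  rw [positivePart_eq_of_apply_eq_norm hφ hvs hv h,
    absoluteValue_eq_of_apply_eq_norm hφ.1 hvs hv h]
  simp only [smul_apply, add_apply, smul_eq_mul]
  ring

end VonNeumannAlgebra

/-! ### From projections to the center. -/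

namespace VonNeumannAlgebra

open Filter Topology

variable {H : Type*} [NormedAddCommGroup H] [InnerProductSpace ℂ H] [CompleteSpace H]
variable {M : VonNeumannAlgebra H} {φ ψ ω : Functional M} {a : M.toStarSubalgebra}

section Projections

theorem mem_of_forall_commute {a : M.toStarSubalgebra} {x : H →L[ℂ] H}
    (h : ∀ y : H →L[ℂ] H, Commute (a : H →L[ℂ] H) y → Commute x y) : x ∈ M.toStarSubalgebra := by
  have key : x ∈ Set.centralizer (Set.centralizer (M : Set (H →L[ℂ] H))) :=
    fun y hy => (h y (hy _ a.2)).symm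
  rw [centralizer_centralizer] at key
  exact key

theorem exists_sub_eq_of_isSelfAdjoint {k : M.toStarSubalgebra} (hk : IsSelfAdjoint k) :
    ∃ b c : M.toStarSubalgebra, 0 ≤ b ∧ 0 ≤ c ∧ k = b - c ∧ c * b = 0 := by
  have hk' : IsSelfAdjoint (k : H →L[ℂ] H) := congrArg Subtype.val hk
  refine ⟨⟨(k : H →L[ℂ] H)⁺, mem_of_forall_commute fun y hy => Commute.cfcₙ_real hy _⟩,
    ⟨(k : H →L[ℂ] H)⁻, mem_of_forall_commute fun y hy => Commute.cfcₙ_real hy _⟩,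
    CFC.posPart_nonneg (k : H →L[ℂ] H), CFC.negPart_nonneg (k : H →L[ℂ] H),
    Subtype.ext (CFC.posPart_sub_negPart (k : H →L[ℂ] H)).symm,
    Subtype.ext (CFC.negPart_mul_posPart (k : H →L[ℂ] H))⟩

/-- One binary digit of `h`: the projection is the range projection of the positive part of `2h -
1`, and the remainder is again in `[0, 1]`. -/
theorem exists_projection_double_sub {h : M.toStarSubalgebra} (h0 : 0 ≤ h) (h1 : h ≤ 1) :
    ∃ p : M.toStarSubalgebra, IsStarProjection p ∧ 0 ≤ h + h - p ∧ h + h - p ≤ 1 := by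
  have hh : IsSelfAdjoint h := IsSelfAdjoint.of_nonneg h0
  obtain ⟨b, c, hb, hc, hk, hcb⟩ := exists_sub_eq_of_isSelfAdjoint
    (k := h + h - 1) ((hh.add hh).sub (IsSelfAdjoint.one _))
  obtain ⟨s, hs, hs1, hs2⟩ := exists_projection_eq_span (M := M) (Set.range (b : H →L[ℂ] H))
  have hsb : s * b = b := Subtype.ext (ContinuousLinearMap.ext fun ξ => hs1 _ ⟨ξ, rfl⟩)
  have hcs : c * s = 0 := hs2 c (by
    rintro _ ⟨ξ, rfl⟩
    exact congrArg (fun x : M.toStarSubalgebra => (x : H →L[ℂ] H) ξ) hcb)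
  have hbs : b * s = b := by
    have := congrArg star hsb
    rwa [star_mul, hs.isSelfAdjoint.star_eq, (IsSelfAdjoint.of_nonneg hb).star_eq] at this
  have hsc : s * c = 0 := by
    have := congrArg star hcs
    rwa [star_mul, hs.isSelfAdjoint.star_eq, (IsSelfAdjoint.of_nonneg hc).star_eq,
      star_zero] at this
  have hss : s * s = s := hs.isIdempotentElem.eq
  have hk' : h + h = b - c + 1 := by rw [← hk]; abel
  refine ⟨s, hs, ?_, ?_⟩
  · have e1 : h + h - s = b + star (1 - s) * (h + h) * (1 - s) := by
      rw [hs.one_sub.isSelfAdjoint.star_eq, hk']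
      simp only [sub_mul, mul_sub, mul_add, add_mul, one_mul, mul_one, hsb, hbs, hcs, hsc, hss,
        zero_mul]
      abel
    rw [e1]
    exact add_nonneg hb (star_left_conjugate_nonneg (add_nonneg h0 h0) _)
  · have e1 : 1 - (h + h - s) = c + star s * ((1 - h) + (1 - h)) * s := by
      have e2 : (1 - h) + (1 - h) = 1 - b + c := by
        have : (1 - h) + (1 - h) = 1 + 1 - (h + h) := by abel
        rw [this, hk']; abel
      rw [hs.isSelfAdjoint.star_eq, e2, hk']
      simp only [sub_mul, mul_sub, mul_add, add_mul, mul_one, hsb, hbs, hsc, hss, zero_mul]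
      abel
    rw [← sub_nonneg, e1]
    have h2 := sub_nonneg.2 h1
    exact add_nonneg hc (star_left_conjugate_nonneg (add_nonneg h2 h2) _)

/-- If `a` commutes with projections, then `[a, 2h - p] = 2[a, h]`. The commutators with elements of
`[0, 1]` are uniformly bounded, so iterated doubling forces them to vanish. -/
theorem commute_of_forall_projection
    (ha : ∀ p : M.toStarSubalgebra, IsStarProjection p → Commute a p) (x : M.toStarSubalgebra) :
    Commute a x := by
  have key : ∀ (n : ℕ) (h : M.toStarSubalgebra), 0 ≤ h → h ≤ 1 →
      2 ^ n * ‖a * h - h * a‖ ≤ 2 * ‖a‖ := by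
    intro n
    induction n with
    | zero =>
      intro h h0 h1
      have h2 := norm_le_one_of_nonneg h0 h1
      have h3 := norm_sub_le (a * h) (h * a)
      have h4 := norm_mul_le a h
      have h5 := norm_mul_le h a
      have h6 := norm_nonneg a
      rw [pow_zero, one_mul]
      nlinarith
    | succ n ih =>
      intro h h0 h1
      obtain ⟨p, hp, hp0, hp1⟩ := exists_projection_double_sub h0 h1
      have h2 := ih _ hp0 hp1
      have h3 : a * (h + h - p) - (h + h - p) * a = (2 : ℂ) • (a * h - h * a) := by
        have := (ha p hp).eq
        rw [mul_sub, sub_mul, this, mul_add, add_mul, two_smul]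
        abel
      rw [h3, norm_smul, RCLike.norm_ofNat] at h2
      rw [pow_succ]
      linarith
  have h1 : ∀ h : M.toStarSubalgebra, 0 ≤ h → h ≤ 1 → Commute a h := by
    intro h h0 h1
    by_contra hne
    have hpos : 0 < ‖a * h - h * a‖ := norm_pos_iff.2 (sub_ne_zero.2 hne)
    obtain ⟨n, hn⟩ := pow_unbounded_of_one_lt (2 * ‖a‖ / ‖a * h - h * a‖) (one_lt_two)
    rw [div_lt_iff₀ hpos] at hn
    exact absurd (key n h h0 h1) (not_le.2 hn)
  have h2 : ∀ h : M.toStarSubalgebra, 0 ≤ h → Commute a h := by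
    intro h h0
    have hc : (0 : ℝ) < (‖h‖ + 1)⁻¹ := by positivity
    have h3 : 0 ≤ (((‖h‖ + 1)⁻¹ : ℝ) : ℂ) • h := by
      rw [nonneg_coe_iff] at h0 ⊢
      exact smul_nonneg (by exact_mod_cast hc.le) h0
    have h4 := h1 _ h3 (by
      refine sub_nonneg.1 (one_sub_nonneg_of_norm_le_one (IsSelfAdjoint.of_nonneg h3) ?_)
      rw [norm_smul, Complex.norm_real, Real.norm_of_nonneg hc.le,
        inv_mul_le_iff₀ (by positivity)]
      linarith)
    have h5 := h4.smul_right ((‖h‖ + 1 : ℝ) : ℂ)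
    rwa [smul_smul, ← Complex.ofReal_mul, mul_inv_cancel₀ (by positivity), Complex.ofReal_one,
      one_smul] at h5
  have h3 : ∀ k : M.toStarSubalgebra, IsSelfAdjoint k → Commute a k := by
    intro k hk
    obtain ⟨b, c, hb, hc, rfl, -⟩ := exists_sub_eq_of_isSelfAdjoint hk
    exact (h2 b hb).sub_right (h2 c hc)
  have h4 := (h3 _ (realPart x).2).add_right ((h3 _ (imaginaryPart x).2).smul_right Complex.I)
  rwa [realPart_add_I_smul_imaginaryPart] at h4

theorem commute_of_conjugate_le {p : M.toStarSubalgebra} (ha : 0 ≤ a) (hp : IsStarProjection p)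
    (h : p * a * p ≤ a) : Commute a p := by
  have hb := sub_nonneg.2 h
  have hpp : p * p = p := hp.isIdempotentElem.eq
  have hps := hp.isSelfAdjoint.star_eq
  have h1 : star (sqrt (a - p * a * p) * p) * (sqrt (a - p * a * p) * p) = 0 := by
    rw [star_mul, star_sqrt, hps]
    calc _ = p * (sqrt (a - p * a * p) * sqrt (a - p * a * p)) * p := by simp only [mul_assoc]
      _ = 0 := by
        rw [sqrt_mul_sqrt hb, mul_sub, sub_mul, mul_assoc p a p, ← mul_assoc p p, hpp,
          mul_assoc p (a * p), mul_assoc a, hpp, sub_self]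
  rw [CStarRing.star_mul_self_eq_zero_iff] at h1
  have h2 : (a - p * a * p) * p = 0 := by
    rw [← sqrt_mul_sqrt hb, mul_assoc, h1, mul_zero]
  have h3 : a * p = p * a * p := by
    rw [sub_mul, mul_assoc (p * a), hpp, sub_eq_zero] at h2
    exact h2
  have h4 := congrArg star h3
  rw [star_mul, star_mul, star_mul, hps, (IsSelfAdjoint.of_nonneg ha).star_eq, ← mul_assoc] at h4
  exact h3.trans h4.symm

theorem mem_center_of_forall_conjugate_le (ha : 0 ≤ a)
    (h : ∀ p : M.toStarSubalgebra, IsStarProjection p → p * a * p ≤ a) :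
    a ∈ Subalgebra.center ℂ M.toStarSubalgebra :=
  Subalgebra.mem_center_iff.2 fun x =>
    (commute_of_forall_projection (fun p hp => commute_of_conjugate_le ha hp (h p hp)) x).symm.eq

end Projections

/-! ### Cone operations and positive homogeneity. -/

section Cone

theorem IsHermitian.add (hφ : IsHermitian φ) (hψ : IsHermitian ψ) : IsHermitian (φ + ψ) :=
  fun x => by rw [add_apply, add_apply, hφ, hψ, star_add]

theorem IsHermitian.sub (hφ : IsHermitian φ) (hψ : IsHermitian ψ) : IsHermitian (φ - ψ) :=
  fun x => by rw [sub_apply, sub_apply, hφ, hψ, star_sub]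

theorem add_mem_hermitianPredual (hφ : φ ∈ M.hermitianPredual) (hψ : ψ ∈ M.hermitianPredual) :
    φ + ψ ∈ M.hermitianPredual :=
  ⟨hφ.1.add hψ.1, hφ.2.add hψ.2⟩

theorem sub_mem_hermitianPredual (hφ : φ ∈ M.hermitianPredual) (hψ : ψ ∈ M.hermitianPredual) :
    φ - ψ ∈ M.hermitianPredual :=
  ⟨hφ.1.sub hψ.1, hφ.2.sub hψ.2⟩

theorem real_smul_eq (t : ℝ) (φ : Functional M) : t • φ = (t : ℂ) • φ := by
  ext x; simp

theorem smul_mem_hermitianPredual (t : ℝ) (hφ : φ ∈ M.hermitianPredual) :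
    t • φ ∈ M.hermitianPredual := by
  refine ⟨real_smul_eq t φ ▸ hφ.1.smul t, fun x => ?_⟩
  rw [smul_apply, smul_apply, hφ.2]; simp

theorem mem_hermitianPredual_of_mem_positivePredual (hφ : φ ∈ M.positivePredual) :
    φ ∈ M.hermitianPredual :=
  ⟨hφ.1, hφ.2.isHermitian⟩

theorem add_mem_positivePredual (hφ : φ ∈ M.positivePredual) (hψ : ψ ∈ M.positivePredual) :
    φ + ψ ∈ M.positivePredual :=
  ⟨hφ.1.add hψ.1, fun x hx => add_nonneg (hφ.2 x hx) (hψ.2 x hx)⟩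

theorem smul_mem_positivePredual {t : ℝ} (ht : 0 ≤ t) (hφ : φ ∈ M.positivePredual) :
    t • φ ∈ M.positivePredual := by
  refine ⟨real_smul_eq t φ ▸ hφ.1.smul t, fun x hx => ?_⟩
  rw [smul_apply]
  exact smul_nonneg ht (hφ.2 x hx)

theorem zero_mem_positivePredual : (0 : Functional M) ∈ M.positivePredual :=
  ⟨⟨0, 0, by simp, by simp,
    fun x => by simp⟩, fun x _ => le_rfl⟩

theorem positivePart_of_mem_positivePredual (hφ : φ ∈ M.positivePredual) : positivePart φ = φ :=
  IsPositivePart.eq_positivePart (mem_hermitianPredual_of_mem_positivePredual hφ)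
    ⟨hφ, 0, zero_mem_positivePredual, by simp, by simp⟩

theorem positivePart_neg_of_mem_positivePredual (hφ : φ ∈ M.positivePredual) :
    positivePart (-φ) = 0 :=
  IsPositivePart.eq_positivePart
    (zero_sub φ ▸ sub_mem_hermitianPredual
      (mem_hermitianPredual_of_mem_positivePredual zero_mem_positivePredual)
      (mem_hermitianPredual_of_mem_positivePredual hφ))
    ⟨zero_mem_positivePredual, φ, hφ, by simp, by simp⟩

theorem positivePart_smul {t : ℝ} (ht : 0 ≤ t) (hφ : φ ∈ M.hermitianPredual) :
    positivePart (t • φ) = t • positivePart φ := by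
  obtain ⟨h1, χ, hχ, h2, h3⟩ := isPositivePart_positivePart hφ
  refine IsPositivePart.eq_positivePart (smul_mem_hermitianPredual t hφ)
    ⟨smul_mem_positivePredual ht h1, t • χ, smul_mem_positivePredual ht hχ, ?_, ?_⟩
  · exact (congrArg (t • ·) h2).trans (by ext x; simp [mul_sub])
  · rw [norm_smul, norm_smul, norm_smul, h3, mul_add]

theorem absoluteValue_smul_apply {t : ℝ} (ht : 0 ≤ t) (hφ : φ ∈ M.hermitianPredual)
    (x : M.toStarSubalgebra) : absoluteValue (t • φ) x = t • absoluteValue φ x := by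
  rw [absoluteValue_apply (smul_mem_hermitianPredual t hφ), absoluteValue_apply hφ,
    positivePart_smul ht hφ, smul_apply, smul_apply, smul_sub, mul_smul_comm]

theorem convexOn_iff_subadditive {E F : Type*} [AddCommGroup E] [Module ℝ E] [AddCommGroup F]
    [PartialOrder F] [IsOrderedAddMonoid F] [Module ℝ F] [PosSMulMono ℝ F] {S : Set E}
    (hadd : ∀ x ∈ S, ∀ y ∈ S, x + y ∈ S) (hsmul : ∀ t : ℝ, ∀ x ∈ S, t • x ∈ S) {f : E → F}
    (hf : ∀ t : ℝ, 0 ≤ t → ∀ x ∈ S, f (t • x) = t • f x) :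
    ConvexOn ℝ S f ↔ ∀ x ∈ S, ∀ y ∈ S, f (x + y) ≤ f x + f y := by
  constructor
  · intro h x hx y hy
    have h1 := h.2 hx hy (show (0 : ℝ) ≤ 2⁻¹ by norm_num) (show (0 : ℝ) ≤ 2⁻¹ by norm_num)
      (by norm_num)
    have h2 : x + y = (2 : ℝ) • ((2⁻¹ : ℝ) • x + (2⁻¹ : ℝ) • y) := by
      rw [← smul_add, smul_smul]; norm_num
    rw [h2, hf 2 (by norm_num) _ (hadd _ (hsmul _ _ hx) _ (hsmul _ _ hy))]
    refine (smul_le_smul_of_nonneg_left h1 (by norm_num : (0 : ℝ) ≤ 2)).trans_eq ?_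
    rw [← smul_add, smul_smul]; norm_num
  · intro h
    refine ⟨fun x hx y hy a b _ _ _ => hadd _ (hsmul _ _ hx) _ (hsmul _ _ hy),
      fun x hx y hy a b ha hb _ => ?_⟩
    rw [← hf a ha x hx, ← hf b hb y hy]
    exact h _ (hsmul _ _ hx) _ (hsmul _ _ hy)

end Cone

end VonNeumannAlgebra

/-! ### Test functionals, and the consequences of centrality. -/

namespace VonNeumannAlgebra

open Filter Topology

variable {H : Type*} [NormedAddCommGroup H] [InnerProductSpace ℂ H] [CompleteSpace H]
variable {M : VonNeumannAlgebra H} {φ ψ ω φ₁ φ₂ : Functional M} {a : M.toStarSubalgebra}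

section Conjugate

/-- The functional `y ↦ φ (c* y c)`. -/
noncomputable def conjugate (c : M.toStarSubalgebra) (φ : Functional M) : Functional M :=
  rmul (lmul (star c) φ) c

theorem conjugate_apply (c : M.toStarSubalgebra) (φ : Functional M) (y : M.toStarSubalgebra) :
    conjugate c φ y = φ (star c * (y * c)) := rfl

theorem conjugate_mem_positivePredual (c : M.toStarSubalgebra) (hφ : φ ∈ M.positivePredual) :
    conjugate c φ ∈ M.positivePredual := by
  refine ⟨(hφ.1.left_mul _).right_mul _, fun x hx => ?_⟩
  rw [conjugate_apply, ← mul_assoc]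
  exact hφ.2 _ (star_left_conjugate_nonneg hx c)

theorem isPositivePart_conjugate_sub {p : M.toStarSubalgebra} (hp : IsStarProjection p)
    (hω : ω ∈ M.positivePredual) (hψ : ψ ∈ M.positivePredual) :
    IsPositivePart (conjugate p ω - conjugate (1 - p) ψ) (conjugate p ω) := by
  have h1 := conjugate_mem_positivePredual p hω
  have h2 := conjugate_mem_positivePredual (1 - p) hψ
  refine ⟨h1, _, h2, rfl, le_antisymm (norm_sub_le _ _) ?_⟩
  have hpp : p * p = p := hp.isIdempotentElem.eq
  have hps := hp.isSelfAdjoint.star_eq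
  have hqs := hp.one_sub.isSelfAdjoint.star_eq
  have hqq : (1 - p) * (1 - p) = 1 - p := hp.one_sub.isIdempotentElem.eq
  have hpq : p * (1 - p) = 0 := hp.mul_one_sub_self
  have hqp : (1 - p) * p = 0 := hp.one_sub_mul_self
  -- The symmetry `2p - 1` is where the difference attains the sum of the two norms.
  have hn : ‖p - (1 - p)‖ ≤ 1 := by
    refine norm_le_one_of_star_mul_self (le_of_eq ?_)
    have : (p - (1 - p)) * (p - (1 - p)) =
        p * p - p * (1 - p) - (1 - p) * p + (1 - p) * (1 - p) := by noncomm_ring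
    rw [star_sub, hps, hqs, this, hpp, hqp, hpq, hqq]
    abel
  have e1 : conjugate p ω (p - (1 - p)) = conjugate p ω 1 := by
    rw [conjugate_apply, conjugate_apply, sub_mul, hpp, hqp, sub_zero, one_mul]
  have e2 : conjugate (1 - p) ψ (p - (1 - p)) = -conjugate (1 - p) ψ 1 := by
    rw [conjugate_apply, conjugate_apply, sub_mul, hqq, hpq, zero_sub, one_mul, mul_neg, map_neg]
  have h3 := (conjugate p ω - conjugate (1 - p) ψ).le_opNorm (p - (1 - p))
  rw [sub_apply, e1, e2, sub_neg_eq_add, h1.2.apply_one, h2.2.apply_one, ← Complex.ofReal_add,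
    Complex.norm_real, Real.norm_of_nonneg (by positivity)] at h3
  exact h3.trans (mul_le_of_le_one_right (norm_nonneg _) hn)

end Conjugate

section VectorFunctional

/-- The functional `x ↦ ⟪ξ, x ξ⟫`. -/
noncomputable def vectorFunctional (M : VonNeumannAlgebra H) (ξ : H) : Functional M :=
  LinearMap.mkContinuous
    { toFun := fun x : M.toStarSubalgebra => ⟪ξ, (x : H →L[ℂ] H) ξ⟫_ℂ
      map_add' := fun x y => inner_add_right _ _ _
      map_smul' := fun c x => inner_smul_right _ _ _ } (‖ξ‖ * ‖ξ‖) fun x => by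
    refine (norm_inner_le_norm _ _).trans ?_
    rw [mul_assoc, mul_comm ‖ξ‖ ‖x‖]
    exact mul_le_mul_of_nonneg_left ((x : H →L[ℂ] H).le_opNorm ξ) (norm_nonneg _)

theorem vectorFunctional_mem_positivePredual (ξ : H) :
    vectorFunctional M ξ ∈ M.positivePredual := by
  have hs : Summable fun n => ‖(Pi.single 0 ξ : ℕ → H) n‖ ^ 2 :=
    summable_of_ne_finset_zero (s := {0}) fun n hn => by
      rw [Pi.single_eq_of_ne (by simpa using hn)]; simp
  refine ⟨⟨Pi.single 0 ξ, Pi.single 0 ξ, hs, hs, fun x => ?_⟩, fun x hx => ?_⟩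
  · have := hasSum_single (f := fun n => ⟪(Pi.single 0 ξ : ℕ → H) n,
      (x : H →L[ℂ] H) ((Pi.single 0 ξ : ℕ → H) n)⟫_ℂ) 0 fun n hn => by
        rw [Pi.single_eq_of_ne hn, inner_zero_left]
    rwa [Pi.single_eq_same] at this
  · exact ((ContinuousLinearMap.nonneg_iff_isPositive _).1 hx).inner_nonneg_right ξ

theorem nonneg_of_forall_vectorFunctional {x : M.toStarSubalgebra}
    (h : ∀ ξ, 0 ≤ vectorFunctional M ξ x) : 0 ≤ x := by
  rw [nonneg_coe_iff, ContinuousLinearMap.nonneg_iff_isPositive]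
  refine isPositive_of_denseRange (e := id) denseRange_id fun ξ => ?_
  rw [id, ← inner_conj_symm, ← Complex.star_def]
  exact star_nonneg_iff.2 (h ξ)

end VectorFunctional

section Central

theorem sqrt_commute (ha : a ∈ Subalgebra.center ℂ M.toStarSubalgebra)
    (x : M.toStarSubalgebra) : sqrt a * x = x * sqrt a := by
  have h : Commute (a : H →L[ℂ] H) x :=
    congrArg Subtype.val (Subalgebra.mem_center_iff.1 ha x).symm
  exact Subtype.ext (Commute.cfcₙ_nnreal h NNReal.sqrt).eq

theorem positivePart_apply_le_of_mem_center (ha0 : 0 ≤ a)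
    (ha : a ∈ Subalgebra.center ℂ M.toStarSubalgebra) (hφ : φ ∈ M.hermitianPredual)
    (h₁ : IsPositive φ₁) (h₂ : IsPositive φ₂) (h : φ = φ₁ - φ₂) : positivePart φ a ≤ φ₁ a := by
  obtain ⟨v, hvs, hv, hφv⟩ := exists_isSelfAdjoint_apply_eq_norm hφ
  rw [positivePart_eq_of_apply_eq_norm hφ hvs hv hφv]
  have hr : star (sqrt a) = sqrt a := star_sqrt a
  have hconj : ∀ x, star (sqrt a) * x * sqrt a = x * a := by
    intro x
    rw [hr, sqrt_commute ha, mul_assoc, sqrt_mul_sqrt ha0]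
  have h3 := h₁ _ (star_left_conjugate_nonneg (one_sub_nonneg_of_norm_le_one hvs hv) (sqrt a))
  have h4 := h₂ _ (star_left_conjugate_nonneg (one_sub_nonneg_of_norm_le_one (x := -v)
    (by rw [IsSelfAdjoint, star_neg, hvs]) (by rwa [norm_neg])) (sqrt a))
  rw [hconj, sub_mul, one_mul, map_sub] at h3
  rw [hconj, sub_mul, one_mul, map_sub, neg_mul, map_neg] at h4
  have h0 : (0 : ℂ) ≤ 2⁻¹ := by rw [Complex.nonneg_iff]; norm_num
  rw [← sub_nonneg]
  refine (mul_nonneg h0 (add_nonneg h3 h4)).trans_eq ?_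
  rw [h, smul_apply, add_apply, lmul_apply, sub_apply, sub_apply, smul_eq_mul]
  ring

/-- With `φ = uω` and `√a` central, `√aφ√a = u(√aω√a)` and conversely via `u*`. The norms therefore
agree, and that of the positive `√aω√a` is its value `ω(a)` at `1`. -/
theorem absoluteValue_apply_of_mem_center (ha0 : 0 ≤ a)
    (ha : a ∈ Subalgebra.center ℂ M.toStarSubalgebra) (hφ : IsNormal φ) :
    absoluteValue φ a = (‖rmul (lmul (sqrt a) φ) (sqrt a)‖ : ℂ) := by
  have hω := absoluteValue_spec hφ
  obtain ⟨u, hu, h1, h2⟩ := hω.exists_lmul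
  set ω := absoluteValue φ
  set θ := rmul (lmul (sqrt a) φ) (sqrt a) with hθ
  have hp := conjugate_mem_positivePredual (sqrt a) hω.1
  have e1 : θ = lmul u (conjugate (sqrt a) ω) := by
    ext y
    rw [hθ, rmul_apply, lmul_apply, lmul_apply, conjugate_apply, star_sqrt, h1, lmul_apply]
    congr 1
    rw [← mul_assoc, ← sqrt_commute ha u]
    simp only [mul_assoc]
  have e2 : conjugate (sqrt a) ω = lmul (star u) θ := by
    ext y
    rw [lmul_apply, hθ, rmul_apply, lmul_apply, conjugate_apply, star_sqrt]
    conv_lhs => rw [h2]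
    rw [lmul_apply]
    congr 1
    rw [← mul_assoc, ← sqrt_commute ha (star u)]
    simp only [mul_assoc]
  have e3 : ‖θ‖ = ‖conjugate (sqrt a) ω‖ := by
    refine le_antisymm ?_ ?_
    · rw [e1]; exact norm_lmul_le hu
    · conv_lhs => rw [e2]
      exact norm_lmul_le (by rwa [norm_star])
  rw [e3, ← hp.2.apply_one, conjugate_apply, star_sqrt, one_mul, sqrt_mul_sqrt ha0]

end Central

theorem conjugate_le_of_forall_positivePart_apply_le (ha : 0 ≤ a)
    (h : ∀ φ ∈ M.hermitianPredual, ∀ φ₁ ∈ M.positivePredual, ∀ φ₂ ∈ M.positivePredual,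
      φ = φ₁ - φ₂ → positivePart φ a ≤ φ₁ a)
    {p : M.toStarSubalgebra} (hp : IsStarProjection p) : p * a * p ≤ a := by
  have hps := hp.isSelfAdjoint.star_eq
  have hqs := hp.one_sub.isSelfAdjoint.star_eq
  rw [← sub_nonneg]
  refine nonneg_of_forall_vectorFunctional fun ξ => ?_
  set ω := vectorFunctional M ξ
  have hω : ω ∈ M.positivePredual := vectorFunctional_mem_positivePredual ξ
  have hωp := conjugate_mem_positivePredual p hω
  have key : ∀ t : ℝ, 0 < t → t ≤ 1 → conjugate p ω a ≤ ω a + t ^ 2 • conjugate p ω a := by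
    intro t ht ht1
    have hs : 0 ≤ (t⁻¹) ^ 2 - 1 := by
      rw [sub_nonneg]
      exact one_le_pow₀ ((one_le_inv₀ ht).2 ht1)
    set ψ := ((t⁻¹) ^ 2 - 1) • ω
    have hψ : ψ ∈ M.positivePredual := smul_mem_positivePredual hs hω
    have h1 := isPositivePart_conjugate_sub hp hω hψ
    have hmem := sub_mem_hermitianPredual (mem_hermitianPredual_of_mem_positivePredual hωp)
      (mem_hermitianPredual_of_mem_positivePredual (conjugate_mem_positivePredual (1 - p) hψ))
    have h2 := h _ hmem (ω + t ^ 2 • conjugate p ω)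
      (add_mem_positivePredual hω (smul_mem_positivePredual (sq_nonneg t) hωp))
      -- The weights `t` and `t⁻¹` have product one, so the off-diagonal terms cancel those of `ω`.
      (conjugate ((t : ℂ) • p + ((t⁻¹ : ℝ) : ℂ) • (1 - p)) ω)
      (conjugate_mem_positivePredual _ hω) (by
        ext y
        have hy : ω y = ω (p * (y * p)) + ω (p * (y * (1 - p))) + ω ((1 - p) * (y * p)) +
            ω ((1 - p) * (y * (1 - p))) := by
          rw [← map_add, ← map_add, ← map_add]
          congr 1
          noncomm_ring
        have ht' : (t : ℂ) * (t : ℂ)⁻¹ = 1 := mul_inv_cancel₀ (by exact_mod_cast ht.ne')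
        simp only [sub_apply, add_apply, smul_apply, conjugate_apply, star_add, star_smul, hps,
          hqs, Complex.star_def, Complex.conj_ofReal, ψ, add_mul, mul_add, smul_mul_assoc,
          mul_smul_comm, map_add, map_smul, smul_eq_mul, Complex.real_smul]
        rw [hy]
        push_cast
        linear_combination (ω (p * (y * (1 - p))) + ω ((1 - p) * (y * p))) * ht')
    rw [h1.eq_positivePart hmem] at h2
    exact h2
  have e : conjugate p ω a = ω (p * a * p) := by rw [conjugate_apply, hps, mul_assoc]
  have h0 := (Complex.nonneg_iff.1 (hω.2 a ha)).2
  have h1 := (Complex.nonneg_iff.1 (hωp.2 a ha)).2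
  rw [map_sub, ← e, sub_nonneg, Complex.le_def]
  refine ⟨?_, by rw [← h0, ← h1]⟩
  have hlim : Tendsto (fun n : ℕ => (ω a).re + (1 / ((n : ℝ) + 1)) ^ 2 * (conjugate p ω a).re)
      atTop (𝓝 ((ω a).re + 0 ^ 2 * (conjugate p ω a).re)) :=
    tendsto_const_nhds.add ((tendsto_one_div_add_atTop_nhds_zero_nat.pow 2).mul_const _)
  simp only [ne_eq, OfNat.ofNat_ne_zero, not_false_eq_true, zero_pow, zero_mul, add_zero] at hlim
  refine ge_of_tendsto' hlim fun n => ?_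
  have h2 := (Complex.le_def.1 (key (1 / ((n : ℝ) + 1)) (by positivity)
    ((div_le_one (by positivity)).2 (by linarith [n.cast_nonneg (α := ℝ)])))).1
  rwa [Complex.add_re, Complex.smul_re, smul_eq_mul] at h2

end VonNeumannAlgebra

/-! ### The equivalences. -/

theorem corollary1 {H : Type*} [NormedAddCommGroup H] [InnerProductSpace ℂ H] [CompleteSpace H]
    (M : VonNeumannAlgebra H) (a : M.toStarSubalgebra) (ha : 0 ≤ a) :
    List.TFAE [
      -- (i)
      a ∈ Subalgebra.center ℂ M.toStarSubalgebra,
      -- (ii)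
      ∀ p : M.toStarSubalgebra, IsStarProjection p → p * a * p ≤ a,
      -- (iii)
      ∀ φ ∈ M.hermitianPredual, ∀ φ₁ ∈ M.positivePredual, ∀ φ₂ ∈ M.positivePredual,
        φ = φ₁ - φ₂ → VonNeumannAlgebra.positivePart φ a ≤ φ₁ a,
      -- (iv)
      ∀ φ ∈ M.hermitianPredual, ∀ ψ ∈ M.hermitianPredual,
        VonNeumannAlgebra.IsPositive (ψ - φ) →
          VonNeumannAlgebra.positivePart φ a ≤ VonNeumannAlgebra.positivePart ψ a,
      -- (v)
      ∀ φ ∈ M.hermitianPredual, ∀ ψ ∈ M.hermitianPredual,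
        VonNeumannAlgebra.positivePart (φ + ψ) a ≤
          VonNeumannAlgebra.positivePart φ a + VonNeumannAlgebra.positivePart ψ a,
      -- (vi)
      ∀ φ ∈ M.hermitianPredual, ∀ ψ ∈ M.hermitianPredual,
        VonNeumannAlgebra.absoluteValue (φ + ψ) a ≤
          VonNeumannAlgebra.absoluteValue φ a + VonNeumannAlgebra.absoluteValue ψ a,
      -- (vii)
      ConvexOn ℝ M.hermitianPredual (fun φ => VonNeumannAlgebra.positivePart φ a),
      -- (viii)
      ConvexOn ℝ M.hermitianPredual (fun φ => VonNeumannAlgebra.absoluteValue φ a),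
      -- (ix)
      ∀ φ : VonNeumannAlgebra.Functional M, VonNeumannAlgebra.IsNormal φ →
        VonNeumannAlgebra.absoluteValue φ a =
          (‖VonNeumannAlgebra.rmul (VonNeumannAlgebra.lmul (VonNeumannAlgebra.sqrt a) φ)
            (VonNeumannAlgebra.sqrt a)‖ : ℂ),
      -- (x)
      ∀ φ ψ : VonNeumannAlgebra.Functional M, VonNeumannAlgebra.IsNormal φ →
        VonNeumannAlgebra.IsNormal ψ →
          VonNeumannAlgebra.absoluteValue (φ + ψ) a ≤
            VonNeumannAlgebra.absoluteValue φ a + VonNeumannAlgebra.absoluteValue ψ a] := by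
  have hsmul : ∀ t : ℝ, ∀ φ ∈ M.hermitianPredual, t • φ ∈ M.hermitianPredual :=
    fun t φ hφ => VonNeumannAlgebra.smul_mem_hermitianPredual t hφ
  have hadd : ∀ φ ∈ M.hermitianPredual, ∀ ψ ∈ M.hermitianPredual, φ + ψ ∈ M.hermitianPredual :=
    fun φ hφ ψ hψ => VonNeumannAlgebra.add_mem_hermitianPredual hφ hψ
  tfae_have 1 → 3 := fun h φ hφ φ₁ h₁ φ₂ h₂ hsub =>
    VonNeumannAlgebra.positivePart_apply_le_of_mem_center ha h hφ h₁.2 h₂.2 hsub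
  tfae_have 3 → 2 := fun h p hp =>
    VonNeumannAlgebra.conjugate_le_of_forall_positivePart_apply_le ha h hp
  tfae_have 2 → 1 := VonNeumannAlgebra.mem_center_of_forall_conjugate_le ha
  tfae_have 3 → 4 := by
    intro h φ hφ ψ hψ hle
    obtain ⟨h1, χ, hχ, h2, -⟩ := VonNeumannAlgebra.isPositivePart_positivePart hψ
    -- `φ = ψ⁺ - (ψ⁻ + (ψ - φ))` is a competing decomposition of `φ`.
    refine h φ hφ _ h1 (χ + (ψ - φ)) (VonNeumannAlgebra.add_mem_positivePredual hχ
      ⟨hψ.1.sub hφ.1, hle⟩) ?_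
    calc φ = ψ - (ψ - φ) := (sub_sub_cancel ψ φ).symm
      _ = (VonNeumannAlgebra.positivePart ψ - χ) - (ψ - φ) := congrArg (· - (ψ - φ)) h2
      _ = _ := sub_sub _ _ _
  tfae_have 4 → 3 := by
    intro h φ hφ φ₁ h₁ φ₂ h₂ hsub
    have h3 := h φ hφ φ₁ (VonNeumannAlgebra.mem_hermitianPredual_of_mem_positivePredual h₁) (by
      rw [hsub, sub_sub_cancel]; exact h₂.2)
    rwa [VonNeumannAlgebra.positivePart_of_mem_positivePredual h₁] at h3
  tfae_have 3 → 5 := by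
    intro h φ hφ ψ hψ
    obtain ⟨h1, χ, hχ, h2, -⟩ := VonNeumannAlgebra.isPositivePart_positivePart hφ
    obtain ⟨h3, ρ, hρ, h4, -⟩ := VonNeumannAlgebra.isPositivePart_positivePart hψ
    exact h _ (hadd φ hφ ψ hψ) _ (VonNeumannAlgebra.add_mem_positivePredual h1 h3) _
      (VonNeumannAlgebra.add_mem_positivePredual hχ hρ)
      ((congrArg₂ (· + ·) h2 h4).trans (sub_add_sub_comm _ _ _ _))
  tfae_have 5 → 3 := by
    intro h φ hφ φ₁ h₁ φ₂ h₂ hsub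
    have hneg : -φ₂ ∈ M.hermitianPredual := zero_sub φ₂ ▸
      VonNeumannAlgebra.sub_mem_hermitianPredual
        (VonNeumannAlgebra.mem_hermitianPredual_of_mem_positivePredual
          VonNeumannAlgebra.zero_mem_positivePredual)
        (VonNeumannAlgebra.mem_hermitianPredual_of_mem_positivePredual h₂)
    -- Subadditivity for `φ₁ + (-φ₂)`, where `(-φ₂)⁺ = 0`.
    have h3 := h φ₁ (VonNeumannAlgebra.mem_hermitianPredual_of_mem_positivePredual h₁) _ hneg
    rwa [VonNeumannAlgebra.positivePart_of_mem_positivePredual h₁,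
      VonNeumannAlgebra.positivePart_neg_of_mem_positivePredual h₂, ← sub_eq_add_neg, ← hsub,
      zero_apply, add_zero] at h3
  tfae_have 5 ↔ 6 := by
    -- By `|φ| = 2φ⁺ - φ`, the linear terms cancel and the two subadditivity defects differ by a
    -- factor `2`.
    refine forall₄_congr fun φ hφ ψ hψ => ?_
    rw [VonNeumannAlgebra.absoluteValue_apply (hadd φ hφ ψ hψ),
      VonNeumannAlgebra.absoluteValue_apply hφ, VonNeumannAlgebra.absoluteValue_apply hψ]
    have h2 : ∀ z : ℂ, 0 ≤ z ↔ 0 ≤ 2 * z := fun z => by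
      rw [Complex.nonneg_iff, Complex.nonneg_iff]; simp [eq_comm]
    rw [add_apply, ← sub_nonneg, h2]
    refine Iff.trans ?_ sub_nonneg
    ring_nf
  tfae_have 5 ↔ 7 := (VonNeumannAlgebra.convexOn_iff_subadditive hadd hsmul
    (f := fun φ => VonNeumannAlgebra.positivePart φ a)
    fun t ht φ hφ => by rw [VonNeumannAlgebra.positivePart_smul ht hφ, smul_apply]).symm
  tfae_have 6 ↔ 8 := (VonNeumannAlgebra.convexOn_iff_subadditive hadd hsmul
    (f := fun φ => VonNeumannAlgebra.absoluteValue φ a)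
    fun t ht φ hφ => VonNeumannAlgebra.absoluteValue_smul_apply ht hφ a).symm
  tfae_have 1 → 9 := fun h φ hφ => VonNeumannAlgebra.absoluteValue_apply_of_mem_center ha h hφ
  tfae_have 9 → 10 := by
    intro h φ ψ hφ hψ
    rw [h _ (hφ.add hψ), h _ hφ, h _ hψ, ← Complex.ofReal_add, Complex.real_le_real]
    exact norm_add_le
      (VonNeumannAlgebra.rmul (VonNeumannAlgebra.lmul (VonNeumannAlgebra.sqrt a) φ)
        (VonNeumannAlgebra.sqrt a))
      (VonNeumannAlgebra.rmul (VonNeumannAlgebra.lmul (VonNeumannAlgebra.sqrt a) ψ)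
        (VonNeumannAlgebra.sqrt a))
  tfae_have 10 → 6 := fun h φ hφ ψ hψ => h φ ψ hφ.1 hψ.1
  tfae_finish
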